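/- Let $(M,g)$ be a smooth $n$-dimensional Riemannian manifold (Hausdorff, second countable) with Levi-Civita connection $\nabla$, curvature tensor $R(X,Y,Z,U)=g(\nabla_X\nabla_YZ-\nabla_Y\nabla_XZ-\nabla_{[X,Y]}Z,U)$ and scalar curvature $\tau$, and assume $d\tau\neq 0$ at every point of $M$. For a 2-plane $E\subset T_pM$ with orthonormal basis $\{x,y\}$ let $\varphi_E(z)=(\nabla_zR)(x,y,y,x)$, $z\in E$ (this does not depend on the orthonormal basis). Let $\xi$ be a smooth unit vector field on $M$ with dual 1-form $\eta=g(\xi,\cdot)$, and let $\Delta=\ker\eta$. Suppose that $(M,g)$ is directed by $\eta$, that is, $\varphi_E=k(E,p)\,\eta|_E$ for all 2-planes $E\subset T_pM$, $E\not\subset\Delta$, and $\varphi_E=0$ for all 2-planes $E\subset\Delta$; that the relative sectional curvature $k(E,p)$ is pointwise constant, that is, $k(E,p)=k(p)$ does not depend on the 2-plane $E\not\subset\Delta$; and that $\eta$ is oriented so that $$k=\frac{2\,\|d\tau\|}{(n-1)(n+2)}.$$ Suppose further that the scalar distribution $\ker d\tau$ is totally umbilical, that is, it has a smooth unit normal field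 $\nu$ such that $\nabla_x\nu=\lambda x$ for all $x\in\ker d\tau$, where $\lambda$ is a function on $M$. Then the following hold. 1. The function $k$ is constant on every connected integral submanifold (an injectively immersed $(n-1)$-dimensional submanifold whose tangent spaces are the hyperplanes $\ker d\tau$) of the scalar distribution if and only if $d\eta=0$. 2. The function $k$ is constant on every connected integral submanifold of the scalar distribution if and only if $\xi$ is geodesic, that is, $\nabla_\xi\xi=0$. -/

import Mathlib

open Bundle Manifold
open scoped ContDiff InnerProductSpace

noncomputable section

namespace DirectedRiemannian

universe u

variable {n : ℕ} {M : Type u} [TopologicalSpace M] [ChartedSpace (EuclideanSpace ℝ (Fin n)) M]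
  [IsManifold (𝓡 n) ∞ M]

/-- A vector field `X` on the manifold is smooth. -/
def IsSmoothField (X : ∀ p : M, TangentSpace (𝓡 n) p) : Prop :=
  ContMDiff (𝓡 n) ((𝓡 n).prod 𝓘(ℝ, EuclideanSpace ℝ (Fin n))) ∞
    (fun p ↦ TotalSpace.mk' (EuclideanSpace ℝ (Fin n)) p (X p))

/-- Connections on the tangent bundle. For `D : TangentConnection n M`, the vector
`(D_X Y)(p)` is `D Y p (X p)`. -/
abbrev TangentConnection (n : ℕ) (M : Type u) [TopologicalSpace M]
    [ChartedSpace (EuclideanSpace ℝ (Fin n)) M] [IsManifold (𝓡 n) ∞ M] : Type u :=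
  CovariantDerivative (𝓡 n) (EuclideanSpace ℝ (Fin n)) (fun p : M ↦ TangentSpace (𝓡 n) p)

/-- The curvature operator
`R(X, Y) Z = D_X D_Y Z - D_Y D_X Z - D_{[X, Y]} Z` on vector fields. -/
def curvatureOp (D : TangentConnection n M) (X Y Z : ∀ p : M, TangentSpace (𝓡 n) p) (p : M) :
    TangentSpace (𝓡 n) p :=
  D (fun q ↦ D Z q (Y q)) p (X p) - D (fun q ↦ D Z q (X q)) p (Y p)
    - D Z p (VectorField.mlieBracket (𝓡 n) X Y p)

/-- A 1-form `η` is closed: `dη(X, Y) = X(η(Y)) - Y(η(X)) - η([X, Y])` vanishes for all smooth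
vector fields `X`, `Y`. -/
def IsClosedForm (η : ∀ p : M, TangentSpace (𝓡 n) p →L[ℝ] ℝ) : Prop :=
  ∀ X Y : ∀ p : M, TangentSpace (𝓡 n) p, IsSmoothField X → IsSmoothField Y → ∀ p : M,
    mvfderiv (𝓡 n) (fun q ↦ η q (Y q)) p (X p) - mvfderiv (𝓡 n) (fun q ↦ η q (X q)) p (Y p)
      - η p (VectorField.mlieBracket (𝓡 n) X Y p) = 0

/-- An injectively immersed submanifold `f : S → M` of dimension `n - 1` is an integral submanifold
of the hyperplane distribution `Δ` on the `n`-dimensional manifold `M`: its tangent space at each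
point is the hyperplane of the distribution. -/
structure IsIntegralSubmanifold (Δ : ∀ p : M, Submodule ℝ (TangentSpace (𝓡 n) p))
    {S : Type*} [TopologicalSpace S] [ChartedSpace (EuclideanSpace ℝ (Fin (n - 1))) S]
    (f : S → M) : Prop where
  injective : Function.Injective f
  smooth : ContMDiff (𝓡 (n - 1)) (𝓡 n) ∞ f
  immersive : ∀ s : S, Function.Injective (mfderiv (𝓡 (n - 1)) (𝓡 n) f s)
  tangent : ∀ s : S, ∀ v : TangentSpace (𝓡 n) (f s),
    v ∈ Δ (f s) ↔ ∃ w : TangentSpace (𝓡 (n - 1)) s, mfderiv (𝓡 (n - 1)) (𝓡 n) f s w = v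

/-- The function `k` is constant on every connected integral submanifold of `Δ`.
A connected Hausdorff manifold has at most the cardinality of the continuum, so submanifolds
carried by types in `Type` represent all of them up to diffeomorphism. -/
def IsConstantOnIntegralSubmanifolds (Δ : ∀ p : M, Submodule ℝ (TangentSpace (𝓡 n) p))
    (k : M → ℝ) : Prop :=
  ∀ (S : Type) [TopologicalSpace S] [ChartedSpace (EuclideanSpace ℝ (Fin (n - 1))) S]
    [IsManifold (𝓡 (n - 1)) ∞ S] [ConnectedSpace S] (f : S → M),
    IsIntegralSubmanifold Δ f → ∀ s t : S, k (f s) = k (f t)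

section Metric

variable [RiemannianBundle (fun p : M ↦ TangentSpace (𝓡 n) p)]

/-- The `(0, 4)` curvature tensor on vector fields, `R(X, Y, Z, U) = g(R(X, Y) Z, U)`. -/
def curvature (D : TangentConnection n M) (X Y Z U : ∀ p : M, TangentSpace (𝓡 n) p) (p : M) : ℝ :=
  ⟪curvatureOp D X Y Z p, U p⟫_ℝ

/-- The covariant derivative of the curvature tensor, `(D_W R)(X, Y, Z, U)`, on vector fields. -/
def covDerivCurvature (D : TangentConnection n M) (W X Y Z U : ∀ p : M, TangentSpace (𝓡 n) p)
    (p : M) : ℝ :=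
  mvfderiv (𝓡 n) (curvature D X Y Z U) p (W p)
    - curvature D (fun q ↦ D X q (W q)) Y Z U p
    - curvature D X (fun q ↦ D Y q (W q)) Z U p
    - curvature D X Y (fun q ↦ D Z q (W q)) U p
    - curvature D X Y Z (fun q ↦ D U q (W q)) p

/-- Extension of a tangent vector at `p` to a vector field which is smooth near `p`. The tensors
below are evaluated on tangent vectors through such extensions. -/
abbrev extField {p : M} (v : TangentSpace (𝓡 n) p) : ∀ q : M, TangentSpace (𝓡 n) q :=
  FiberBundle.extend (EuclideanSpace ℝ (Fin n)) v

/-- The curvature tensor at the point `p`. -/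
def curvatureAt (D : TangentConnection n M) (p : M) (x y z u : TangentSpace (𝓡 n) p) : ℝ :=
  curvature D (extField x) (extField y) (extField z) (extField u) p

/-- The tensor `(D_w R)(x, y, z, u)` at the point `p`. -/
def covDerivCurvatureAt (D : TangentConnection n M) (p : M)
    (w x y z u : TangentSpace (𝓡 n) p) : ℝ :=
  covDerivCurvature D (extField w) (extField x) (extField y) (extField z) (extField u) p

instance finiteDimensionalTangent (p : M) : FiniteDimensional ℝ (TangentSpace (𝓡 n) p) :=
  inferInstanceAs (FiniteDimensional ℝ (EuclideanSpace ℝ (Fin n)))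

/-- The scalar curvature `τ(p) = ∑ i j, R(e_i, e_j, e_j, e_i)`, for an orthonormal basis `e` of
the tangent space at `p`. -/
def scalarCurvature (D : TangentConnection n M) (p : M) : ℝ :=
  let e := stdOrthonormalBasis ℝ (TangentSpace (𝓡 n) p)
  ∑ i, ∑ j, curvatureAt D p (e i) (e j) (e j) (e i)

/-- The scalar 1-form `dτ`. -/
def scalarForm (D : TangentConnection n M) (p : M) : TangentSpace (𝓡 n) p →L[ℝ] ℝ :=
  mvfderiv (𝓡 n) (scalarCurvature D) p

/-- The scalar distribution, that is the distribution of the 1-form `dτ`. -/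
def scalarDistribution (D : TangentConnection n M) (p : M) : Submodule ℝ (TangentSpace (𝓡 n) p) :=
  LinearMap.ker (scalarForm D p).toLinearMap

/-- A smooth vector field of unit length. -/
def IsUnitField (ξ : ∀ p : M, TangentSpace (𝓡 n) p) : Prop :=
  IsSmoothField ξ ∧ ∀ p : M, ‖ξ p‖ = 1

/-- The 1-form dual to a vector field with respect to the metric. -/
def dualForm (ξ : ∀ p : M, TangentSpace (𝓡 n) p) (p : M) : TangentSpace (𝓡 n) p →L[ℝ] ℝ :=
  innerSL ℝ (ξ p)

/-- The distribution of a 1-form. -/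
def distributionOf (η : ∀ p : M, TangentSpace (𝓡 n) p →L[ℝ] ℝ) (p : M) :
    Submodule ℝ (TangentSpace (𝓡 n) p) :=
  LinearMap.ker (η p).toLinearMap

/-- The sectional 1-form `φ_E(z) = (D_z R)(x, y, y, x)` of the plane `E` with orthonormal
basis `x, y`. -/
def sectionalForm (D : TangentConnection n M) (p : M) (x y z : TangentSpace (𝓡 n) p) : ℝ :=
  covDerivCurvatureAt D p z x y y x

/-- The manifold is directed by the 1-form `η` with relative sectional curvature `κ`: for every
plane `E` in a tangent space and every orthonormal basis of `E`, the sectional 1-form is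
`κ(E, p) η` on `E` if `E` is not contained in the distribution of `η`, and it vanishes on `E` if
`E` is contained in that distribution. -/
def IsDirectedBy (D : TangentConnection n M) (η : ∀ p : M, TangentSpace (𝓡 n) p →L[ℝ] ℝ)
    (κ : ∀ p : M, Submodule ℝ (TangentSpace (𝓡 n) p) → ℝ) : Prop :=
  ∀ (p : M) (E : Submodule ℝ (TangentSpace (𝓡 n) p)) (x y : TangentSpace (𝓡 n) p),
    ‖x‖ = 1 → ‖y‖ = 1 → ⟪x, y⟫_ℝ = 0 → E = Submodule.span ℝ {x, y} →
    (¬ E ≤ distributionOf η p → ∀ z ∈ E, sectionalForm D p x y z = κ p E * η p z) ∧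
    (E ≤ distributionOf η p → ∀ z ∈ E, sectionalForm D p x y z = 0)

/-- The relative sectional curvature `κ` of the planes not contained in the distribution of `η`
depends only on the point, with value `k p` at `p`. -/
def IsPointwiseConstant (η : ∀ p : M, TangentSpace (𝓡 n) p →L[ℝ] ℝ)
    (κ : ∀ p : M, Submodule ℝ (TangentSpace (𝓡 n) p) → ℝ) (k : M → ℝ) : Prop :=
  ∀ (p : M) (E : Submodule ℝ (TangentSpace (𝓡 n) p)),
    Module.finrank ℝ E = 2 → ¬ E ≤ distributionOf η p → κ p E = k p

/-- A hyperplane distribution `Δ` is totally umbilical: it has a smooth unit normal field `ν`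
such that `D_x ν = l x` for all `x` in `Δ`, where `l` is a function on the manifold. -/
def IsTotallyUmbilical (D : TangentConnection n M)
    (Δ : ∀ p : M, Submodule ℝ (TangentSpace (𝓡 n) p)) : Prop :=
  ∃ ν : ∀ p : M, TangentSpace (𝓡 n) p, IsUnitField ν ∧
    (∀ (p : M) (v : TangentSpace (𝓡 n) p), v ∈ Δ p ↔ ⟪ν p, v⟫_ℝ = 0) ∧
    ∃ l : M → ℝ, ∀ (p : M), ∀ x ∈ Δ p, D ν p x = l p • x

/-- The unit field `ξ` is geodesic: `D_ξ ξ = 0`. -/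
def IsGeodesicField (D : TangentConnection n M) (ξ : ∀ p : M, TangentSpace (𝓡 n) p) : Prop :=
  ∀ p : M, D ξ p (ξ p) = 0

instance isContMDiffRiemannianBundleOne [IsContMDiffRiemannianBundle (𝓡 n) ∞
    (EuclideanSpace ℝ (Fin n)) (fun p : M ↦ TangentSpace (𝓡 n) p)] :
    IsContMDiffRiemannianBundle (𝓡 n) 1 (EuclideanSpace ℝ (Fin n))
      (fun p : M ↦ TangentSpace (𝓡 n) p) :=
  IsContMDiffRiemannianBundle.of_le (n := ∞) (by norm_cast)

/-- `D` is the Levi-Civita connection of the Riemannian metric: the smooth connection on the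
tangent bundle that is torsion-free and compatible with the metric (it exists and is unique on
smooth vector fields). -/
structure IsLeviCivita [IsContMDiffRiemannianBundle (𝓡 n) ∞ (EuclideanSpace ℝ (Fin n))
    (fun p : M ↦ TangentSpace (𝓡 n) p)] (D : TangentConnection n M) : Prop where
  smooth : D.ContMDiffCovariantDerivative ∞
  torsion_free : D.torsion = 0
  metric : D.IsMetricCompatible

end Metric

end DirectedRiemannian

end

noncomputable section

set_option linter.unusedSectionVars false

namespace DirectedRiemannian

universe u

variable {n : ℕ} {M : Type u} [TopologicalSpace M] [ChartedSpace (EuclideanSpace ℝ (Fin n)) M]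
  [IsManifold (𝓡 n) ∞ M]

/-! ### Smooth functions and fields, directional derivatives, Lie bracket -/

open scoped Topology

/-! The point is that `dτ = K η` with `K = (n-1)(n+2)k/2`. Both kinds of planes satisfy `(∇_x
R)(x,y,y,x) = k η(x)` for orthonormal `x, y`. Tracing over `y` and polarizing the resulting cubic
identity in `x`, then tracing again and applying the second Bianchi identity, gives this formula
(`two_mul_trace_eq`, `two_mul_scalarForm`). Since `dτ` has no zeros, neither has `K`, and `ker dτ =
ker η`. From `d(dτ) = 0` follows `dK ∧ η + K dη = 0` (`dirDeriv_wedge_dualForm`), so `dη = 0`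
exactly when `dK` vanishes on `ker dτ` (`isClosedForm_dualForm_iff`). The level sets of `τ` supply
an integral submanifold through every point, so this vanishing is the same as constancy of `K`,
hence of `k`, on the connected integral submanifolds (`isConstantOnIntegralSubmanifolds_iff`). For
the second equivalence, `|ξ| = 1` gives `dη(ξ, ·) = g(∇_ξ ξ, ·)`. As `K dη = -dK ∧ η`, the form `dη`
vanishes as soon as its contraction with `ξ` does (`isGeodesicField_iff_isClosedForm`). Much of the
file builds the tensor calculus needed for this: tensoriality and symmetries of `R` and `∇R`, and
smoothness and differentiation of `τ`. -/

/-- A real function on the manifold is smooth. -/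
def IsSmoothFun (f : M → ℝ) : Prop := ContMDiff (𝓡 n) 𝓘(ℝ, ℝ) ∞ f

/-- The derivative `X f` of a function along a vector field. -/
def dirDeriv (X : ∀ p : M, TangentSpace (𝓡 n) p) (f : M → ℝ) (p : M) : ℝ :=
  mvfderiv (𝓡 n) f p (X p)

/-- The covariant derivative `D_X Y` as a vector field. -/
def covField (D : TangentConnection n M) (X Y : ∀ p : M, TangentSpace (𝓡 n) p) (p : M) :
    TangentSpace (𝓡 n) p :=
  D Y p (X p)

/-- The Lie bracket of vector fields. -/
abbrev lieField (X Y : ∀ p : M, TangentSpace (𝓡 n) p) : ∀ p : M, TangentSpace (𝓡 n) p :=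
  VectorField.mlieBracket (𝓡 n) X Y

variable {X Y Z W : ∀ p : M, TangentSpace (𝓡 n) p} {f g : M → ℝ}

theorem IsSmoothField.mdiffAt (hX : IsSmoothField X) (p : M) :
    MDifferentiableAt (𝓡 n) ((𝓡 n).prod 𝓘(ℝ, EuclideanSpace ℝ (Fin n)))
      (fun q ↦ TotalSpace.mk' (EuclideanSpace ℝ (Fin n)) q (X q)) p :=
  (ContMDiff.mdifferentiable hX (by simp)) p

theorem IsSmoothFun.mdiffAt (hf : IsSmoothFun (n := n) f) (p : M) :
    MDifferentiableAt (𝓡 n) 𝓘(ℝ, ℝ) f p :=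
  (ContMDiff.mdifferentiable hf (by simp)) p

theorem IsSmoothField.add (hX : IsSmoothField X) (hY : IsSmoothField Y) : IsSmoothField (X + Y) :=
  ContMDiff.add_section hX hY

theorem IsSmoothField.sub (hX : IsSmoothField X) (hY : IsSmoothField Y) : IsSmoothField (X - Y) :=
  ContMDiff.sub_section hX hY

theorem IsSmoothField.neg (hX : IsSmoothField X) : IsSmoothField (-X) :=
  ContMDiff.neg_section hX

theorem IsSmoothField.smul (hf : IsSmoothFun (n := n) f) (hX : IsSmoothField X) :
    IsSmoothField (f • X) :=
  ContMDiff.smul_section hf hX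

theorem IsSmoothFun.mul (hf : IsSmoothFun (n := n) f) (hg : IsSmoothFun (n := n) g) :
    IsSmoothFun (n := n) (fun q ↦ f q * g q) :=
  ContMDiff.mul hf hg

theorem two_le_infty : (minSmoothness ℝ 2 : ℕ∞ω) ≤ ∞ := by
  rw [minSmoothness_of_isRCLikeNormedField]; norm_cast

theorem IsSmoothField.lie (hX : IsSmoothField X) (hY : IsSmoothField Y) :
    IsSmoothField (lieField X Y) := by
  intro p
  have : IsManifold (𝓡 n) (minSmoothness ℝ 2) M := IsManifold.of_le (n := ∞) two_le_infty
  have : IsManifold (𝓡 n) (((⊤ : ℕ∞) : ℕ∞ω) + 1) M := IsManifold.of_le (n := ∞) (by simp)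
  have := ContMDiffAt.mlieBracket_vectorField (m := ⊤) (n := ⊤) (I := 𝓡 n)
    (U := X) (V := Y) (x := p) (hX p) (hY p) (by simp)
  exact this

theorem IsSmoothFun.dirDeriv (hf : IsSmoothFun (n := n) f) (hX : IsSmoothField X) :
    IsSmoothFun (n := n) (dirDeriv X f) := by
  have h1 : ContMDiff (𝓡 n).tangent 𝓘(ℝ, ℝ).tangent ∞ (tangentMap (𝓡 n) 𝓘(ℝ, ℝ) f) :=
    ContMDiff.contMDiff_tangentMap hf (by simp)
  exact (contMDiff_snd_tangentBundle_modelSpace ℝ 𝓘(ℝ, ℝ)).comp (h1.comp hX)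

theorem dirDeriv_add (hf : IsSmoothFun (n := n) f) (hg : IsSmoothFun (n := n) g) :
    dirDeriv X (fun q ↦ f q + g q) = fun q ↦ dirDeriv X f q + dirDeriv X g q := by
  ext p
  simp [dirDeriv, mvfderiv_fun_add (hf.mdiffAt p) (hg.mdiffAt p)]

theorem dirDeriv_mul (hf : IsSmoothFun (n := n) f) (hg : IsSmoothFun (n := n) g) :
    dirDeriv X (fun q ↦ f q * g q) = fun q ↦ f q * dirDeriv X g q + g q * dirDeriv X f q := by
  ext p
  simp [dirDeriv, mvfderiv_fun_mul (hf.mdiffAt p) (hg.mdiffAt p)]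

theorem lieField_swap : lieField X Y = - lieField Y X := VectorField.mlieBracket_swap

theorem lieField_add_right (hY : IsSmoothField Y) (hZ : IsSmoothField Z) :
    lieField X (Y + Z) = lieField X Y + lieField X Z := by
  ext1 p
  exact VectorField.mlieBracket_add_right (hY.mdiffAt p) (hZ.mdiffAt p)

theorem lieField_add_left (hY : IsSmoothField Y) (hZ : IsSmoothField Z) :
    lieField (Y + Z) X = lieField Y X + lieField Z X := by
  ext1 p
  exact VectorField.mlieBracket_add_left (hY.mdiffAt p) (hZ.mdiffAt p)

theorem lieField_smul_right (hf : IsSmoothFun (n := n) f) (hY : IsSmoothField Y) :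
    lieField X (f • Y) = dirDeriv X f • Y + f • lieField X Y := by
  ext1 p
  exact VectorField.mlieBracket_smul_right (hf.mdiffAt p) (hY.mdiffAt p)

theorem lieField_smul_left (hf : IsSmoothFun (n := n) f) (hX : IsSmoothField X) :
    lieField (f • X) Y = f • lieField X Y - dirDeriv Y f • X := by
  ext1 p
  rw [lieField, VectorField.mlieBracket_smul_left (hf.mdiffAt p) (hX.mdiffAt p)]
  simp only [Pi.sub_apply, Pi.smul_apply', dirDeriv]
  module

theorem lieField_jacobi (hX : IsSmoothField X) (hY : IsSmoothField Y) (hZ : IsSmoothField Z) :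
    lieField X (lieField Y Z) = lieField (lieField X Y) Z + lieField Y (lieField X Z) := by
  have h := two_le_infty
  have : IsManifold (𝓡 n) (minSmoothness ℝ 3) M :=
    IsManifold.of_le (n := ∞) (by rw [minSmoothness_of_isRCLikeNormedField]; norm_cast)
  exact VectorField.leibniz_identity_mlieBracket (ContMDiff.of_le hX h) (ContMDiff.of_le hY h)
    (ContMDiff.of_le hZ h)

/-- The Lie bracket acts on functions as the commutator of derivations. -/
theorem dirDeriv_lieField (hX : IsSmoothField X) (hY : IsSmoothField Y)
    (hf : IsSmoothFun (n := n) f) (p : M) :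
    dirDeriv (lieField X Y) f p = dirDeriv X (dirDeriv Y f) p - dirDeriv Y (dirDeriv X f) p := by
  -- The Jacobi identity for `X, Y, f • Z`: after the Leibniz rule and the Jacobi identity for `X,
  -- Y, Z`, only multiples of `Z` survive.
  have key : ∀ Z : ∀ p : M, TangentSpace (𝓡 n) p, IsSmoothField Z →
      dirDeriv (lieField X Y) f p • Z p =
        (dirDeriv X (dirDeriv Y f) p - dirDeriv Y (dirDeriv X f) p) • Z p := by
    intro Z hZ
    have h := congrFun (lieField_jacobi hX hY (hZ.smul hf)) p
    rw [lieField_smul_right hf hZ, lieField_smul_right hf hZ, lieField_smul_right hf hZ,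
      lieField_add_right (hZ.smul (hf.dirDeriv hY)) ((hY.lie hZ).smul hf),
      lieField_add_right (hZ.smul (hf.dirDeriv hX)) ((hX.lie hZ).smul hf),
      lieField_smul_right (hf.dirDeriv hY) hZ, lieField_smul_right (hf.dirDeriv hX) hZ,
      lieField_smul_right hf (hY.lie hZ), lieField_smul_right hf (hX.lie hZ),
      lieField_jacobi hX hY hZ] at h
    simp only [Pi.add_apply, Pi.smul_apply', smul_add] at h
    rw [sub_smul, eq_sub_iff_add_eq]
    have h2 := sub_eq_zero.2 h
    rw [← sub_eq_zero, ← neg_eq_zero, ← h2]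
    module
  -- Cancelling `Z p` needs a field nonzero at `p`: `X` or `Y` itself serves. If both vanish there,
  -- so does their bracket, and every term is zero.
  by_cases hX0 : X p = 0
  · by_cases hY0 : Y p = 0
    · have : lieField X Y p = 0 := by
        have := VectorField.mlieBracketWithin_eq_zero_of_eq_zero (I := 𝓡 n) (s := Set.univ) hX0 hY0
        simpa using this
      simp only [dirDeriv] at *
      simp [this, hX0, hY0]
    · exact smul_left_injective ℝ hY0 (key Y hY)
  · exact smul_left_injective ℝ hX0 (key X hX)

/-! ### Rules for the covariant derivative and the Levi-Civita identities -/

section Connection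

variable (D : TangentConnection n M)

theorem covField_add_left : covField D (X + Y) Z = covField D X Z + covField D Y Z := by
  ext1 p; simp [covField]

theorem covField_sub_left : covField D (X - Y) Z = covField D X Z - covField D Y Z := by
  ext1 p; simp [covField]

theorem covField_neg_left : covField D (-X) Z = -covField D X Z := by
  ext1 p; simp [covField]

theorem covField_smul_left : covField D (f • X) Z = f • covField D X Z := by
  ext1 p; simp [covField]

theorem covField_add_right (hY : IsSmoothField Y) (hZ : IsSmoothField Z) :
    covField D X (Y + Z) = covField D X Y + covField D X Z := by
  ext1 p
  simp [covField, D.isCovariantDerivativeOn.add (hY.mdiffAt p) (hZ.mdiffAt p)]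

theorem covField_smul_right (hf : IsSmoothFun (n := n) f) (hY : IsSmoothField Y) :
    covField D X (f • Y) = f • covField D X Y + dirDeriv X f • Y := by
  ext1 p
  simp [covField, D.isCovariantDerivativeOn.leibniz (hY.mdiffAt p) (hf.mdiffAt p), dirDeriv]

theorem covField_neg_right (hY : IsSmoothField Y) : covField D X (-Y) = -covField D X Y := by
  ext1 p
  have := D.isCovariantDerivativeOn.smul_const (-1 : ℝ) (hY.mdiffAt p)
  simp only [neg_smul, one_smul] at this
  simp [covField, this]

theorem covField_sub_right (hY : IsSmoothField Y) (hZ : IsSmoothField Z) :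
    covField D X (Y - Z) = covField D X Y - covField D X Z := by
  rw [sub_eq_add_neg, covField_add_right D hY hZ.neg, covField_neg_right D hZ, ← sub_eq_add_neg]

end Connection

section Metric

variable [RiemannianBundle (fun p : M ↦ TangentSpace (𝓡 n) p)]
  [IsContMDiffRiemannianBundle (𝓡 n) ∞ (EuclideanSpace ℝ (Fin n))
    (fun p : M ↦ TangentSpace (𝓡 n) p)]
  {D : TangentConnection n M}

theorem IsSmoothField.inner (hX : IsSmoothField X) (hY : IsSmoothField Y) :
    IsSmoothFun (n := n) (fun q ↦ ⟪X q, Y q⟫_ℝ) :=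
  ContMDiff.inner_bundle hX hY

theorem IsSmoothField.cov (hD : IsLeviCivita D) (hX : IsSmoothField X) (hY : IsSmoothField Y) :
    IsSmoothField (covField D X Y) := by
  have h := hD.smooth.contMDiff.contMDiff (σ := Y) (contMDiffOn_univ.2 hY)
  exact ContMDiff.clm_bundle_apply (contMDiffOn_univ.1 h) hX

theorem covField_torsion (hD : IsLeviCivita D) (hX : IsSmoothField X) (hY : IsSmoothField Y) :
    covField D X Y - covField D Y X = lieField X Y := by
  ext1 p
  exact (D.torsion_eq_zero_iff.1 hD.torsion_free) (hX.mdiffAt p) (hY.mdiffAt p)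

theorem dirDeriv_inner (hD : IsLeviCivita D) (hX : IsSmoothField X) (hY : IsSmoothField Y) :
    dirDeriv W (fun q ↦ ⟪X q, Y q⟫_ℝ) =
      fun q ↦ ⟪covField D W X q, Y q⟫_ℝ + ⟪X q, covField D W Y q⟫_ℝ := by
  ext1 p
  exact hD.metric.mvfderiv_inner_eq W (hX.mdiffAt p) (hY.mdiffAt p)

end Metric

/-! ### Passing from local to global smooth fields; tensoriality -/

section Localization

variable {X Y : ∀ p : M, TangentSpace (𝓡 n) p}

/-- A vector field which is smooth on a neighbourhood of `p` agrees near `p` with a globally smooth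
one. -/
theorem exists_isSmoothField_eventuallyEq [T2Space M] {u : Set M} {p : M} (hu : u ∈ 𝓝 p)
    (hX : ContMDiffOn (𝓡 n) ((𝓡 n).prod 𝓘(ℝ, EuclideanSpace ℝ (Fin n))) ∞
      (fun q ↦ TotalSpace.mk' (EuclideanSpace ℝ (Fin n)) q (X q)) u) :
    ∃ X' : ∀ p : M, TangentSpace (𝓡 n) p, IsSmoothField X' ∧ ∀ᶠ q in 𝓝 p, X' q = X q := by
  obtain ⟨ρ, hρ⟩ := (SmoothBumpFunction.nhds_basis_tsupport (I := 𝓡 n) p).mem_iff.1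
    (interior_mem_nhds.2 hu)
  refine ⟨(ρ : M → ℝ) • X, ?_, ?_⟩
  · exact ContMDiffOn.smul_section_of_tsupport (ρ.contMDiff.contMDiffOn) isOpen_interior hρ.2
      (hX.mono interior_subset)
  · filter_upwards [ρ.eventuallyEq_one] with q hq
    simp [hq]

theorem exists_isSmoothField_extField [T2Space M] {p : M} (v : TangentSpace (𝓡 n) p) :
    ∃ X : ∀ p : M, TangentSpace (𝓡 n) p, IsSmoothField X ∧
      ∀ᶠ q in 𝓝 p, X q = extField v q := by
  obtain ⟨s, hs, h⟩ := FiberBundle.exists_contMDiffOn_extend (𝓡 n) (EuclideanSpace ℝ (Fin n)) (k := ∞) v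
  exact exists_isSmoothField_eventuallyEq hs h

theorem exists_isSmoothField_apply [T2Space M] {p : M} (v : TangentSpace (𝓡 n) p) :
    ∃ X : ∀ p : M, TangentSpace (𝓡 n) p, IsSmoothField X ∧ X p = v := by
  obtain ⟨X, hX, h⟩ := exists_isSmoothField_extField v
  exact ⟨X, hX, by simpa using h.self_of_nhds⟩

/-- An operation on smooth vector fields which is linear over smooth functions at `p` depends
only on the value of the vector field at `p`. -/
theorem eq_of_tensorial [T2Space M] {p : M} (Φ : (∀ p : M, TangentSpace (𝓡 n) p) → ℝ)
    (hadd : ∀ X Y, IsSmoothField X → IsSmoothField Y → Φ (X + Y) = Φ X + Φ Y)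
    (hsmul : ∀ (f : M → ℝ) X, IsSmoothFun (n := n) f → IsSmoothField X → Φ (f • X) = f p * Φ X)
    (hX : IsSmoothField X) (hY : IsSmoothField Y) (h : X p = Y p) : Φ X = Φ Y := by
  have h0 : ∀ Z, IsSmoothField Z → Z p = 0 → Φ Z = 0 := by
    intro Z hZ hZp
    obtain ⟨ρ⟩ : Nonempty (SmoothBumpFunction (𝓡 n) p) := inferInstance
    have hρ : IsSmoothFun (n := n) ρ := ρ.contMDiff
    let e := trivializationAt (EuclideanSpace ℝ (Fin n)) (TangentSpace (𝓡 n) : M → Type _) p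
    let b := (EuclideanSpace.basisFun (Fin n) ℝ).toBasis
    let s := e.localFrame b
    have he : e.baseSet = (chartAt (EuclideanSpace ℝ (Fin n)) p).source :=
      TangentBundle.trivializationAt_baseSet p
    let c : Fin n → M → ℝ := fun i q ↦ e.localFrameCoeff (𝓡 n) b i q (Z q)
    have hc : ∀ i, ContMDiffOn (𝓡 n) 𝓘(ℝ, ℝ) ∞ (c i) e.baseSet := fun i ↦
      contMDiffOn_baseSet_localFrameCoeff b (ContMDiff.contMDiffOn hZ) i
    have hs : ∀ i, IsSmoothField ((ρ : M → ℝ) • s i) := fun i ↦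
      ContMDiffOn.smul_section_of_tsupport (ρ.contMDiff.contMDiffOn) e.open_baseSet
        (he ▸ ρ.tsupport_subset_chartAt_source)
        (e.contMDiffOn_localFrame_baseSet _ b i)
    have hf : ∀ i, IsSmoothFun (n := n) (fun q ↦ ρ q * c i q) := fun i ↦
      ρ.contMDiff_smul (g := c i) (he ▸ hc i)
    have hsum : ∀ t : Finset (Fin n),
        IsSmoothField (∑ i ∈ t, (fun q ↦ ρ q * c i q) • ((ρ : M → ℝ) • s i)) ∧
        Φ (∑ i ∈ t, (fun q ↦ ρ q * c i q) • ((ρ : M → ℝ) • s i)) = 0 := by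
      intro t
      induction t using Finset.induction_on with
      | empty =>
        have h00 : IsSmoothField (0 : ∀ p : M, TangentSpace (𝓡 n) p) := by
          have := hZ.sub hZ
          rwa [sub_self] at this
        refine ⟨by simpa using h00, ?_⟩
        have := hadd 0 0 h00 h00
        simpa using this
      | insert a t ha ih =>
        rw [Finset.sum_insert ha]
        refine ⟨((hs a).smul (hf a)).add ih.1, ?_⟩
        rw [hadd _ _ ((hs a).smul (hf a)) ih.1, ih.2, hsmul _ _ (hf a) (hs a)]
        have : c a p = 0 := by simp [c, hZp]
        simp [this]
    -- The coefficients and the frame are both only local, so each needs its own cutoff, whence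
    -- `ρ²`. The coefficients vanish at `p`, so `Φ` kills the sum, while `ρ p = 1` recovers `Φ Z`.
    have hZ2 : (fun q ↦ ρ q * ρ q) • Z = ∑ i, (fun q ↦ ρ q * c i q) • ((ρ : M → ℝ) • s i) := by
      ext1 q
      by_cases hq : q ∈ e.baseSet
      · have := e.eq_sum_localFrameCoeff_smul (I := 𝓡 n) (b := b) (s := Z) hq
        conv_lhs => rw [Pi.smul_apply', this]
        simp only [Finset.sum_apply, Pi.smul_apply', Finset.smul_sum, smul_smul, c, s]
        refine Finset.sum_congr rfl fun i _ ↦ ?_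
        congr 1
        simp only [Pi.mul_apply]
        ring
      · have h0 : ρ q = 0 := by
          by_contra h
          exact hq (he ▸ ρ.tsupport_subset_chartAt_source (subset_tsupport _ h))
        simp [h0, Finset.sum_apply]
    have := hsmul _ _ (hρ.mul hρ) hZ
    rw [hZ2, (hsum _).2] at this
    simpa using this.symm
  have h1 := hadd _ _ hY (hX.sub hY)
  rw [h0 _ (hX.sub hY) (by simp [h]), add_sub_cancel, add_zero] at h1
  exact h1

end Localization

/-! ### Symmetries and tensoriality of the curvature -/

section Curvature

variable {X Y Z W U X' Y' Z' W' U' : ∀ p : M, TangentSpace (𝓡 n) p} {f : M → ℝ}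

/-- A quadrilinear expression with the antisymmetries of a curvature tensor and the first Bianchi
identity is symmetric under exchange of the two pairs. -/
theorem pair_symm_of_bianchi {α : Type*} (P : α → Prop) (R : α → α → α → α → ℝ)
    (h12 : ∀ x y z u, P x → P y → P z → P u → R x y z u = -R y x z u)
    (h34 : ∀ x y z u, P x → P y → P z → P u → R x y z u = -R x y u z)
    (hb : ∀ x y z u, P x → P y → P z → P u → R x y z u + R y z x u + R z x y u = 0)
    {x y z u : α} (hx : P x) (hy : P y) (hz : P z) (hu : P u) : R x y z u = R z u x y := by
  -- The octahedron argument: the four Bianchi sums on cyclic rotations of `x, y, z, u` are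
  -- combined, and the antisymmetries cancel all but the two wanted terms.
  linarith [hb x y z u hx hy hz hu, hb y z u x hy hz hu hx, hb z u x y hz hu hx hy,
    hb u x y z hu hx hy hz, h34 x y z u hx hy hz hu, h34 y z x u hy hz hx hu,
    h34 z x y u hz hx hy hu, h34 y z u x hy hz hu hx, h34 z u y x hz hu hy hx,
    h34 u y z x hu hy hz hx, h34 z u x y hz hu hx hy, h34 u x z y hu hx hz hy,
    h34 x z u y hx hz hu hy, h34 u x y z hu hx hy hz, h34 x y u z hx hy hu hz,
    h34 y u x z hy hu hx hz, h12 u y z x hu hy hz hx, h12 x z u y hx hz hu hy,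
    h12 z x y u hz hx hy hu, h12 u x y z hu hx hy hz, h12 y u x z hy hu hx hz,
    h12 u y x z hu hy hx hz, h12 x z y u hx hz hy hu, h12 z x u y hz hx hu hy,
    h12 u x z y hu hx hz hy, h12 y z u x hy hz hu hx]

section Connection

variable (D : TangentConnection n M)

theorem curvatureOp_eq : curvatureOp D X Y Z =
    covField D X (covField D Y Z) - covField D Y (covField D X Z)
      - covField D (lieField X Y) Z := rfl

theorem curvatureOp_swap : curvatureOp D X Y Z = -curvatureOp D Y X Z := by
  rw [curvatureOp_eq, curvatureOp_eq, lieField_swap, covField_neg_left]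
  module

end Connection

variable [RiemannianBundle (fun p : M ↦ TangentSpace (𝓡 n) p)]
  [IsContMDiffRiemannianBundle (𝓡 n) ∞ (EuclideanSpace ℝ (Fin n))
    (fun p : M ↦ TangentSpace (𝓡 n) p)]
  {D : TangentConnection n M}

theorem IsSmoothField.curvatureOp (hD : IsLeviCivita D) (hX : IsSmoothField X)
    (hY : IsSmoothField Y) (hZ : IsSmoothField Z) : IsSmoothField (curvatureOp D X Y Z) :=
  ((hX.cov hD (hY.cov hD hZ)).sub (hY.cov hD (hX.cov hD hZ))).sub ((hX.lie hY).cov hD hZ)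

theorem curvatureOp_add_left (hD : IsLeviCivita D) (hX : IsSmoothField X) (hX' : IsSmoothField X')
    (hZ : IsSmoothField Z) :
    curvatureOp D (X + X') Y Z = curvatureOp D X Y Z + curvatureOp D X' Y Z := by
  simp only [curvatureOp_eq, covField_add_left, lieField_add_left hX hX',
    covField_add_right D (hX.cov hD hZ) (hX'.cov hD hZ)]
  module

theorem curvatureOp_sub_left (hD : IsLeviCivita D) (hX : IsSmoothField X) (hX' : IsSmoothField X')
    (hZ : IsSmoothField Z) :
    curvatureOp D (X - X') Y Z = curvatureOp D X Y Z - curvatureOp D X' Y Z := by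
  rw [eq_sub_iff_add_eq, ← curvatureOp_add_left hD (hX.sub hX') hX' hZ, sub_add_cancel]

theorem curvatureOp_smul_left (hD : IsLeviCivita D) (hf : IsSmoothFun (n := n) f)
    (hX : IsSmoothField X) (hZ : IsSmoothField Z) :
    curvatureOp D (f • X) Y Z = f • curvatureOp D X Y Z := by
  simp only [curvatureOp_eq, covField_smul_left, lieField_smul_left hf hX, covField_sub_left,
    covField_smul_right D hf (hX.cov hD hZ)]
  ext1 p
  simp only [Pi.sub_apply, Pi.add_apply, Pi.smul_apply']
  module

/-- First Bianchi identity. -/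
theorem curvatureOp_bianchi (hD : IsLeviCivita D) (hX : IsSmoothField X) (hY : IsSmoothField Y)
    (hZ : IsSmoothField Z) :
    curvatureOp D X Y Z + curvatureOp D Y Z X + curvatureOp D Z X Y = 0 := by
  -- Two uses of vanishing torsion turn the derivatives into a double bracket, so the cyclic sum of
  -- curvatures becomes the Jacobi identity.
  have h : ∀ {A B C : ∀ p : M, TangentSpace (𝓡 n) p}, IsSmoothField A → IsSmoothField B →
      IsSmoothField C → covField D A (covField D B C) - covField D A (covField D C B)
        - covField D (lieField B C) A = lieField A (lieField B C) := by
    intro A B C hA hB hC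
    rw [← covField_sub_right D (hB.cov hD hC) (hC.cov hD hB), covField_torsion hD hB hC,
      covField_torsion hD hA (hB.lie hC)]
  have hJ := lieField_jacobi hX hY hZ
  rw [lieField_swap (X := lieField X Y), lieField_swap (X := X) (Y := Z)] at hJ
  have e : lieField Y (-lieField Z X) = - lieField Y (lieField Z X) := by
    ext1 p
    have := VectorField.mlieBracket_const_smul_right (V := Y) (c := (-1 : ℝ)) ((hZ.lie hX).mdiffAt p)
    simpa using this
  rw [e] at hJ
  simp only [curvatureOp_eq]
  linear_combination (norm := module) h hX hY hZ + h hY hZ hX + h hZ hX hY + hJ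

theorem curvature_swap_left (D : TangentConnection n M) :
    curvature D X Y Z U = -curvature D Y X Z U := by
  ext p
  simp only [curvature, Pi.neg_apply]
  rw [curvatureOp_swap]
  simp

/-- Apply `[X, Y] = XY - YX` to the function `g(Z, U)` and expand by metric compatibility; the mixed
first-order products cancel. -/
theorem curvature_swap_right (hD : IsLeviCivita D) (hX : IsSmoothField X) (hY : IsSmoothField Y)
    (hZ : IsSmoothField Z) (hU : IsSmoothField U) :
    curvature D X Y Z U = -curvature D X Y U Z := by
  ext p
  have h := dirDeriv_lieField hX hY (hZ.inner hU) p
  rw [dirDeriv_inner hD hZ hU, dirDeriv_inner hD hZ hU, dirDeriv_inner hD hZ hU,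
    dirDeriv_add ((hY.cov hD hZ).inner hU) (hZ.inner (hY.cov hD hU)),
    dirDeriv_add ((hX.cov hD hZ).inner hU) (hZ.inner (hX.cov hD hU)),
    dirDeriv_inner hD (hY.cov hD hZ) hU, dirDeriv_inner hD hZ (hY.cov hD hU),
    dirDeriv_inner hD (hX.cov hD hZ) hU, dirDeriv_inner hD hZ (hX.cov hD hU)] at h
  simp only [curvature, Pi.neg_apply, curvatureOp_eq, Pi.sub_apply, inner_sub_left]
  simp only [real_inner_comm (Z p)] at h ⊢
  linarith

theorem curvature_bianchi (hD : IsLeviCivita D) (hX : IsSmoothField X) (hY : IsSmoothField Y)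
    (hZ : IsSmoothField Z) (U : ∀ p : M, TangentSpace (𝓡 n) p) (p : M) :
    curvature D X Y Z U p + curvature D Y Z X U p + curvature D Z X Y U p = 0 := by
  simp only [curvature, ← inner_add_left]
  have := congrFun (curvatureOp_bianchi hD hX hY hZ) p
  simp only [Pi.add_apply] at this
  simp [this]

theorem curvature_pair_symm (hD : IsLeviCivita D) (hX : IsSmoothField X) (hY : IsSmoothField Y)
    (hZ : IsSmoothField Z) (hU : IsSmoothField U) :
    curvature D X Y Z U = curvature D Z U X Y := by
  ext p
  refine pair_symm_of_bianchi IsSmoothField (fun X Y Z U ↦ curvature D X Y Z U p)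
    ?_ ?_ ?_ hX hY hZ hU
  · intro X Y Z U _ _ _ _
    exact congrFun (curvature_swap_left D) p
  · intro X Y Z U hX hY hZ hU
    exact congrFun (curvature_swap_right hD hX hY hZ hU) p
  · intro X Y Z U hX hY hZ hU
    exact curvature_bianchi hD hX hY hZ U p

theorem IsSmoothField.curvature (hD : IsLeviCivita D) (hX : IsSmoothField X)
    (hY : IsSmoothField Y) (hZ : IsSmoothField Z) (hU : IsSmoothField U) :
    IsSmoothFun (n := n) (curvature D X Y Z U) :=
  (hX.curvatureOp hD hY hZ).inner hU

theorem curvature_add_left (hD : IsLeviCivita D) (hX : IsSmoothField X) (hX' : IsSmoothField X')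
    (hZ : IsSmoothField Z) : curvature D (X + X') Y Z U =
      fun q ↦ curvature D X Y Z U q + curvature D X' Y Z U q := by
  ext q
  simp only [curvature, curvatureOp_add_left hD hX hX' hZ, Pi.add_apply, inner_add_left]

theorem curvature_smul_left (hD : IsLeviCivita D) (hf : IsSmoothFun (n := n) f)
    (hX : IsSmoothField X) (hZ : IsSmoothField Z) : curvature D (f • X) Y Z U =
      fun q ↦ f q * curvature D X Y Z U q := by
  ext q
  simp only [curvature, curvatureOp_smul_left hD hf hX hZ, Pi.smul_apply', inner_smul_left]
  simp

/-- Linearity over functions is checked in the first slot only; the symmetries carry each other slot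
to this position. -/
theorem curvature_congr_left [T2Space M] (hD : IsLeviCivita D) (hX : IsSmoothField X)
    (hX' : IsSmoothField X') (hZ : IsSmoothField Z) {p : M} (h : X p = X' p) :
    curvature D X Y Z U p = curvature D X' Y Z U p := by
  refine eq_of_tensorial (fun X ↦ curvature D X Y Z U p) ?_ ?_ hX hX' h
  · intro X X' hX hX'
    simp [curvature_add_left hD hX hX' hZ]
  · intro f X hf hX
    simp [curvature_smul_left hD hf hX hZ]

/-- The curvature at `p` depends only on the values of the vector fields at `p`. -/
theorem curvature_congr [T2Space M] (hD : IsLeviCivita D) (hX : IsSmoothField X)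
    (hY : IsSmoothField Y) (hZ : IsSmoothField Z) (hU : IsSmoothField U)
    (hX' : IsSmoothField X') (hY' : IsSmoothField Y') (hZ' : IsSmoothField Z')
    (hU' : IsSmoothField U') {p : M}
    (h1 : X p = X' p) (h2 : Y p = Y' p) (h3 : Z p = Z' p) (h4 : U p = U' p) :
    curvature D X Y Z U p = curvature D X' Y' Z' U' p := by
  rw [curvature_congr_left hD hX hX' hZ h1, curvature_swap_left, Pi.neg_apply,
    curvature_congr_left hD hY hY' hZ h2, ← Pi.neg_apply, ← curvature_swap_left,
    curvature_pair_symm hD hX' hY' hZ hU, curvature_congr_left hD hZ hZ' hX' h3,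
    curvature_swap_left, Pi.neg_apply, curvature_congr_left hD hU hU' hX' h4, ← Pi.neg_apply,
    ← curvature_swap_left, ← curvature_pair_symm hD hX' hY' hZ' hU']

end Curvature

/-! ### Symmetries, second Bianchi identity and tensoriality of `∇R` -/

section CovDerivCurvature

variable {X Y Z W U X' Y' Z' W' U' : ∀ p : M, TangentSpace (𝓡 n) p} {f : M → ℝ}
  [RiemannianBundle (fun p : M ↦ TangentSpace (𝓡 n) p)]
  [IsContMDiffRiemannianBundle (𝓡 n) ∞ (EuclideanSpace ℝ (Fin n))
    (fun p : M ↦ TangentSpace (𝓡 n) p)]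
  {D : TangentConnection n M}

theorem covDerivCurvature_eq (D : TangentConnection n M) (p : M) :
    covDerivCurvature D W X Y Z U p = dirDeriv W (curvature D X Y Z U) p
      - curvature D (covField D W X) Y Z U p - curvature D X (covField D W Y) Z U p
      - curvature D X Y (covField D W Z) U p - curvature D X Y Z (covField D W U) p := rfl

theorem dirDeriv_neg : dirDeriv X (-f) = -dirDeriv X f := by
  ext p
  simp [dirDeriv, mvfderiv_neg]

theorem covDerivCurvature_swap_left (p : M) :
    covDerivCurvature D W X Y Z U p = -covDerivCurvature D W Y X Z U p := by
  simp only [covDerivCurvature_eq]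
  rw [curvature_swap_left D, dirDeriv_neg, curvature_swap_left D (X := covField D W X),
    curvature_swap_left D (Y := covField D W Y),
    curvature_swap_left D (X := X) (Z := covField D W Z),
    curvature_swap_left D (X := X) (U := covField D W U)]
  simp only [Pi.neg_apply]
  ring

theorem covDerivCurvature_swap_right (hD : IsLeviCivita D) (hW : IsSmoothField W)
    (hX : IsSmoothField X) (hY : IsSmoothField Y) (hZ : IsSmoothField Z) (hU : IsSmoothField U)
    (p : M) : covDerivCurvature D W X Y Z U p = -covDerivCurvature D W X Y U Z p := by
  simp only [covDerivCurvature_eq]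
  rw [curvature_swap_right hD hX hY hZ hU, dirDeriv_neg,
    curvature_swap_right hD (hW.cov hD hX) hY hZ hU,
    curvature_swap_right hD hX (hW.cov hD hY) hZ hU,
    curvature_swap_right hD hX hY (hW.cov hD hZ) hU,
    curvature_swap_right hD hX hY hZ (hW.cov hD hU)]
  simp only [Pi.neg_apply]
  ring

theorem covDerivCurvature_pair_symm (hD : IsLeviCivita D) (hW : IsSmoothField W)
    (hX : IsSmoothField X) (hY : IsSmoothField Y) (hZ : IsSmoothField Z) (hU : IsSmoothField U)
    (p : M) : covDerivCurvature D W X Y Z U p = covDerivCurvature D W Z U X Y p := by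
  simp only [covDerivCurvature_eq]
  rw [curvature_pair_symm hD hX hY hZ hU,
    curvature_pair_symm hD (hW.cov hD hX) hY hZ hU,
    curvature_pair_symm hD hX (hW.cov hD hY) hZ hU,
    curvature_pair_symm hD hX hY (hW.cov hD hZ) hU,
    curvature_pair_symm hD hX hY hZ (hW.cov hD hU)]
  ring

theorem covDerivCurvature_add_left (hD : IsLeviCivita D) (hW : IsSmoothField W)
    (hX : IsSmoothField X) (hX' : IsSmoothField X') (hY : IsSmoothField Y) (hZ : IsSmoothField Z)
    (hU : IsSmoothField U) (p : M) : covDerivCurvature D W (X + X') Y Z U p =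
      covDerivCurvature D W X Y Z U p + covDerivCurvature D W X' Y Z U p := by
  simp only [covDerivCurvature_eq, covField_add_right D hX hX', curvature_add_left hD hX hX' hZ,
    curvature_add_left hD hX hX' (hW.cov hD hZ),
    curvature_add_left hD (hW.cov hD hX) (hW.cov hD hX') hZ,
    dirDeriv_add (hX.curvature hD hY hZ hU) (hX'.curvature hD hY hZ hU)]
  ring

theorem covDerivCurvature_smul_left (hD : IsLeviCivita D) (hW : IsSmoothField W)
    (hf : IsSmoothFun (n := n) f)
    (hX : IsSmoothField X) (hY : IsSmoothField Y) (hZ : IsSmoothField Z)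
    (hU : IsSmoothField U) (p : M) : covDerivCurvature D W (f • X) Y Z U p =
      f p * covDerivCurvature D W X Y Z U p := by
  simp only [covDerivCurvature_eq, covField_smul_right D hf hX, curvature_smul_left hD hf hX hZ,
    curvature_smul_left hD hf hX (hW.cov hD hZ),
    curvature_add_left hD ((hW.cov hD hX).smul hf) (hX.smul (hf.dirDeriv hW)) hZ,
    curvature_smul_left hD hf (hW.cov hD hX) hZ,
    curvature_smul_left hD (hf.dirDeriv hW) hX hZ,
    dirDeriv_mul hf (hX.curvature hD hY hZ hU)]
  ring

/-- Metric compatibility absorbs the term differentiating `U`, so that the second Bianchi identity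
becomes an identity of vector fields. -/
theorem covDerivCurvature_eq_inner (hD : IsLeviCivita D)
    (hX : IsSmoothField X) (hY : IsSmoothField Y) (hZ : IsSmoothField Z) (hU : IsSmoothField U)
    (p : M) : covDerivCurvature D W X Y Z U p =
      ⟪covField D W (curvatureOp D X Y Z) p - curvatureOp D (covField D W X) Y Z p
        - curvatureOp D X (covField D W Y) Z p - curvatureOp D X Y (covField D W Z) p, U p⟫_ℝ := by
  rw [covDerivCurvature_eq]
  have : curvature D X Y Z U = fun q ↦ ⟪curvatureOp D X Y Z q, U q⟫_ℝ := rfl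
  rw [this, dirDeriv_inner hD (hX.curvatureOp hD hY hZ) hU]
  simp only [curvature, inner_sub_left]
  ring

/-- Second Bianchi identity. -/
theorem covDerivCurvature_bianchi (hD : IsLeviCivita D) (hW : IsSmoothField W)
    (hX : IsSmoothField X) (hY : IsSmoothField Y) (hZ : IsSmoothField Z) (hU : IsSmoothField U)
    (p : M) : covDerivCurvature D W X Y Z U p + covDerivCurvature D X Y W Z U p
      + covDerivCurvature D Y W X Z U p = 0 := by
  rw [covDerivCurvature_eq_inner hD hX hY hZ hU, covDerivCurvature_eq_inner hD hY hW hZ hU,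
    covDerivCurvature_eq_inner hD hW hX hZ hU, ← inner_add_left, ← inner_add_left]
  have key : ∀ {A B C : ∀ p : M, TangentSpace (𝓡 n) p}, IsSmoothField A → IsSmoothField B →
      IsSmoothField C → curvatureOp D (covField D A B) C Z + curvatureOp D B (covField D A C) Z
        = curvatureOp D (covField D A B) C Z - curvatureOp D (covField D A C) B Z := by
    intro A B C _ _ _
    rw [curvatureOp_swap D (Y := covField D A C)]
    module
  have lie : ∀ {A B C : ∀ p : M, TangentSpace (𝓡 n) p}, IsSmoothField A → IsSmoothField B →
      IsSmoothField C → curvatureOp D (covField D A B) C Z - curvatureOp D (covField D B A) C Z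
        = curvatureOp D (lieField A B) C Z := by
    intro A B C hA hB hC
    rw [← curvatureOp_sub_left hD (hA.cov hD hB) (hB.cov hD hA) hZ, covField_torsion hD hA hB]
  have expand : ∀ {A B C : ∀ p : M, TangentSpace (𝓡 n) p}, IsSmoothField A → IsSmoothField B →
      IsSmoothField C → covField D A (curvatureOp D B C Z) =
        covField D A (covField D B (covField D C Z)) - covField D A (covField D C (covField D B Z))
          - covField D A (covField D (lieField B C) Z) := by
    intro A B C hA hB hC
    rw [curvatureOp_eq, covField_sub_right D, covField_sub_right D]
    · exact hB.cov hD (hC.cov hD hZ)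
    · exact hC.cov hD (hB.cov hD hZ)
    · exact (hB.cov hD (hC.cov hD hZ)).sub (hC.cov hD (hB.cov hD hZ))
    · exact (hB.lie hC).cov hD hZ
  have jac : covField D (lieField (lieField W X) Y) Z + covField D (lieField (lieField X Y) W) Z
      + covField D (lieField (lieField Y W) X) Z = 0 := by
    have hJ := lieField_jacobi hW hX hY
    rw [← covField_add_left, ← covField_add_left]
    have e : lieField (lieField Y W) X = lieField X (lieField W Y) := by
      rw [lieField_swap (X := lieField Y W), lieField_swap (X := Y) (Y := W)]
      ext1 p
      have := VectorField.mlieBracket_const_smul_right (V := X) (c := (-1 : ℝ))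
        ((hW.lie hY).mdiffAt p)
      simp only [neg_smul, one_smul] at this
      simp [lieField, this]
    rw [e, lieField_swap (X := lieField X Y), hJ]
    ext1 p
    simp only [covField, Pi.add_apply, Pi.neg_apply]
    rw [show ∀ a b : TangentSpace (𝓡 n) p, a + -(a + b) + b = 0 from fun a b ↦ by abel]
    simp
  -- In the cyclic sum, `key` and `lie` merge the terms differentiating the first two arguments into
  -- `R([W,X],Y)Z` and its rotations. Third-order derivatives of `Z` cancel, as do the terms with
  -- one bracket and one further derivative; the double brackets that remain vanish by `jac`.
  have total : (covField D W (curvatureOp D X Y Z) - curvatureOp D (covField D W X) Y Z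
        - curvatureOp D X (covField D W Y) Z - curvatureOp D X Y (covField D W Z))
      + (covField D X (curvatureOp D Y W Z) - curvatureOp D (covField D X Y) W Z
        - curvatureOp D Y (covField D X W) Z - curvatureOp D Y W (covField D X Z))
      + (covField D Y (curvatureOp D W X Z) - curvatureOp D (covField D Y W) X Z
        - curvatureOp D W (covField D Y X) Z - curvatureOp D W X (covField D Y Z)) = 0 := by
    have k1 := key hW hX hY
    have k2 := key hX hY hW
    have k3 := key hY hW hX
    have l1 := lie hW hX hY
    have l2 := lie hX hY hW
    have l3 := lie hY hW hX
    rw [expand hW hX hY, expand hX hY hW, expand hY hW hX]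
    rw [curvatureOp_eq D (Z := covField D W Z), curvatureOp_eq D (Z := covField D X Z),
      curvatureOp_eq D (Z := covField D Y Z)]
    rw [curvatureOp_eq D (X := lieField _ _)] at l1 l2 l3
    linear_combination (norm := module) - k1 - k2 - k3 - l1 - l2 - l3 + jac
  have := congrFun total p
  simp only [Pi.add_apply, Pi.sub_apply, Pi.zero_apply] at this
  rw [this, inner_zero_left]

theorem covDerivCurvature_congr_left [T2Space M] (hD : IsLeviCivita D) (hW : IsSmoothField W)
    (hX : IsSmoothField X) (hX' : IsSmoothField X') (hY : IsSmoothField Y) (hZ : IsSmoothField Z)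
    (hU : IsSmoothField U) {p : M} (h : X p = X' p) :
    covDerivCurvature D W X Y Z U p = covDerivCurvature D W X' Y Z U p := by
  refine eq_of_tensorial (fun X ↦ covDerivCurvature D W X Y Z U p) ?_ ?_ hX hX' h
  · intro X X' hX hX'
    exact covDerivCurvature_add_left hD hW hX hX' hY hZ hU p
  · intro f X hf hX
    exact covDerivCurvature_smul_left hD hW hf hX hY hZ hU p

/-- The covariant derivative of the curvature at `p` depends only on the values at `p`. -/
theorem covDerivCurvature_congr [T2Space M] (hD : IsLeviCivita D) (hW : IsSmoothField W)
    (hX : IsSmoothField X) (hY : IsSmoothField Y) (hZ : IsSmoothField Z) (hU : IsSmoothField U)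
    (hW' : IsSmoothField W') (hX' : IsSmoothField X') (hY' : IsSmoothField Y')
    (hZ' : IsSmoothField Z') (hU' : IsSmoothField U') {p : M}
    (h0 : W p = W' p) (h1 : X p = X' p) (h2 : Y p = Y' p) (h3 : Z p = Z' p) (h4 : U p = U' p) :
    covDerivCurvature D W X Y Z U p = covDerivCurvature D W' X' Y' Z' U' p := by
  -- `W` enters only through its value at `p`: directly in the derivative of the function, and via
  -- `∇_W` in slots where the curvature is already tensorial.
  have hWW : covDerivCurvature D W X Y Z U p = covDerivCurvature D W' X Y Z U p := by
    have e : ∀ V : ∀ p : M, TangentSpace (𝓡 n) p, covField D W V p = covField D W' V p := by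
      intro V
      simp [covField, h0]
    simp only [covDerivCurvature_eq, dirDeriv, h0]
    rw [curvature_congr hD (hW.cov hD hX) hY hZ hU (hW'.cov hD hX) hY hZ hU (e X) rfl rfl rfl,
      curvature_congr hD hX (hW.cov hD hY) hZ hU hX (hW'.cov hD hY) hZ hU rfl (e Y) rfl rfl,
      curvature_congr hD hX hY (hW.cov hD hZ) hU hX hY (hW'.cov hD hZ) hU rfl rfl (e Z) rfl,
      curvature_congr hD hX hY hZ (hW.cov hD hU) hX hY hZ (hW'.cov hD hU) rfl rfl rfl (e U)]
  rw [hWW, covDerivCurvature_congr_left hD hW' hX hX' hY hZ hU h1, covDerivCurvature_swap_left,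
    covDerivCurvature_congr_left hD hW' hY hY' hX' hZ hU h2, ← covDerivCurvature_swap_left,
    covDerivCurvature_pair_symm hD hW' hX' hY' hZ hU,
    covDerivCurvature_congr_left hD hW' hZ hZ' hU hX' hY' h3,
    covDerivCurvature_swap_left,
    covDerivCurvature_congr_left hD hW' hU hU' hZ' hX' hY' h4, ← covDerivCurvature_swap_left,
    ← covDerivCurvature_pair_symm hD hW' hX' hY' hZ' hU']

end CovDerivCurvature

/-! ### Locality: evaluating the tensors on `extField` extensions -/

section Germs

variable {X Y Z W U X' Y' Z' W' U' : ∀ p : M, TangentSpace (𝓡 n) p} {p : M}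

theorem IsSmoothField.mdiffAt_of_eventuallyEq (hX : IsSmoothField X)
    (h : ∀ᶠ q in 𝓝 p, X q = X' q) :
    MDifferentiableAt (𝓡 n) ((𝓡 n).prod 𝓘(ℝ, EuclideanSpace ℝ (Fin n)))
      (fun q ↦ TotalSpace.mk' (EuclideanSpace ℝ (Fin n)) q (X' q)) p :=
  (hX.mdiffAt p).congr_of_eventuallyEq (by
    filter_upwards [h] with q hq
    rw [hq])

/-- The pointwise tensors use `extField`, which is smooth only near `p`, so they must be compared
with global fields of the same germ. The conclusion is on a neighbourhood so that it can be iterated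
for second derivatives. -/
theorem covField_eventuallyEq (D : TangentConnection n M) (hY : IsSmoothField Y)
    (hXX : ∀ᶠ q in 𝓝 p, X q = X' q) (hYY : ∀ᶠ q in 𝓝 p, Y q = Y' q) :
    ∀ᶠ q in 𝓝 p, covField D X Y q = covField D X' Y' q := by
  filter_upwards [hXX, eventually_eventually_nhds.2 hYY] with q h1 h2
  rw [covField, covField, h1, D.isCovariantDerivativeOn.congr_of_eventuallyEq (hY.mdiffAt q)
    (hY.mdiffAt_of_eventuallyEq h2) Filter.univ_mem h2]

variable [RiemannianBundle (fun p : M ↦ TangentSpace (𝓡 n) p)]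
  [IsContMDiffRiemannianBundle (𝓡 n) ∞ (EuclideanSpace ℝ (Fin n))
    (fun p : M ↦ TangentSpace (𝓡 n) p)]
  {D : TangentConnection n M}

theorem curvature_eventuallyEq (hD : IsLeviCivita D) (hX : IsSmoothField X) (hY : IsSmoothField Y)
    (hZ : IsSmoothField Z) (hXX : ∀ᶠ q in 𝓝 p, X q = X' q) (hYY : ∀ᶠ q in 𝓝 p, Y q = Y' q)
    (hZZ : ∀ᶠ q in 𝓝 p, Z q = Z' q) (hUU : ∀ᶠ q in 𝓝 p, U q = U' q) :
    ∀ᶠ q in 𝓝 p, curvature D X Y Z U q = curvature D X' Y' Z' U' q := by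
  have hL : ∀ᶠ q in 𝓝 p, lieField X Y q = lieField X' Y' q :=
    Filter.EventuallyEq.mlieBracket_vectorField hXX hYY
  filter_upwards [covField_eventuallyEq D (hY.cov hD hZ) hXX (covField_eventuallyEq D hZ hYY hZZ),
    covField_eventuallyEq D (hX.cov hD hZ) hYY (covField_eventuallyEq D hZ hXX hZZ),
    covField_eventuallyEq D hZ hL hZZ, hUU] with q h1 h2 h3 h4
  simp only [curvature, curvatureOp_eq, Pi.sub_apply, h1, h2, h3, h4]

theorem covDerivCurvature_germ (hD : IsLeviCivita D) (hW : IsSmoothField W) (hX : IsSmoothField X)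
    (hY : IsSmoothField Y) (hZ : IsSmoothField Z) (hU : IsSmoothField U)
    (hWW : ∀ᶠ q in 𝓝 p, W q = W' q) (hXX : ∀ᶠ q in 𝓝 p, X q = X' q)
    (hYY : ∀ᶠ q in 𝓝 p, Y q = Y' q)
    (hZZ : ∀ᶠ q in 𝓝 p, Z q = Z' q) (hUU : ∀ᶠ q in 𝓝 p, U q = U' q) :
    covDerivCurvature D W X Y Z U p = covDerivCurvature D W' X' Y' Z' U' p := by
  have h0 : dirDeriv W (curvature D X Y Z U) p = dirDeriv W' (curvature D X' Y' Z' U') p := by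
    have : mfderiv (𝓡 n) 𝓘(ℝ, ℝ) (curvature D X Y Z U) p =
      mfderiv (𝓡 n) 𝓘(ℝ, ℝ) (curvature D X' Y' Z' U') p :=
      Filter.EventuallyEq.mfderiv_eq (curvature_eventuallyEq hD hX hY hZ hXX hYY hZZ hUU)
    rw [dirDeriv, dirDeriv, mvfderiv, mvfderiv, hWW.self_of_nhds, this,
      (curvature_eventuallyEq hD hX hY hZ hXX hYY hZZ hUU).self_of_nhds]
  have c1 := covField_eventuallyEq D hX hWW hXX
  have c2 := covField_eventuallyEq D hY hWW hYY
  have c3 := covField_eventuallyEq D hZ hWW hZZ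
  have c4 := covField_eventuallyEq D hU hWW hUU
  rw [covDerivCurvature_eq, covDerivCurvature_eq, h0,
    (curvature_eventuallyEq hD (hW.cov hD hX) hY hZ c1 hYY hZZ hUU).self_of_nhds,
    (curvature_eventuallyEq hD hX (hW.cov hD hY) hZ hXX c2 hZZ hUU).self_of_nhds,
    (curvature_eventuallyEq hD hX hY (hW.cov hD hZ) hXX hYY c3 hUU).self_of_nhds,
    (curvature_eventuallyEq hD hX hY hZ hXX hYY hZZ c4).self_of_nhds]

theorem curvatureAt_eq [T2Space M] (hD : IsLeviCivita D) (hX : IsSmoothField X)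
    (hY : IsSmoothField Y) (hZ : IsSmoothField Z) (hU : IsSmoothField U) (p : M) :
    curvatureAt D p (X p) (Y p) (Z p) (U p) = curvature D X Y Z U p := by
  obtain ⟨X', hX', eX⟩ := exists_isSmoothField_extField (X p)
  obtain ⟨Y', hY', eY⟩ := exists_isSmoothField_extField (Y p)
  obtain ⟨Z', hZ', eZ⟩ := exists_isSmoothField_extField (Z p)
  obtain ⟨U', hU', eU⟩ := exists_isSmoothField_extField (U p)
  rw [curvatureAt, ← (curvature_eventuallyEq hD hX' hY' hZ' eX eY eZ eU).self_of_nhds]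
  exact curvature_congr hD hX' hY' hZ' hU' hX hY hZ hU (by simp [eX.self_of_nhds])
    (by simp [eY.self_of_nhds]) (by simp [eZ.self_of_nhds]) (by simp [eU.self_of_nhds])

theorem covDerivCurvatureAt_eq [T2Space M] (hD : IsLeviCivita D) (hW : IsSmoothField W)
    (hX : IsSmoothField X) (hY : IsSmoothField Y) (hZ : IsSmoothField Z) (hU : IsSmoothField U)
    (p : M) : covDerivCurvatureAt D p (W p) (X p) (Y p) (Z p) (U p) =
      covDerivCurvature D W X Y Z U p := by
  obtain ⟨W', hW', eW⟩ := exists_isSmoothField_extField (W p)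
  obtain ⟨X', hX', eX⟩ := exists_isSmoothField_extField (X p)
  obtain ⟨Y', hY', eY⟩ := exists_isSmoothField_extField (Y p)
  obtain ⟨Z', hZ', eZ⟩ := exists_isSmoothField_extField (Z p)
  obtain ⟨U', hU', eU⟩ := exists_isSmoothField_extField (U p)
  rw [covDerivCurvatureAt, ← covDerivCurvature_germ hD hW' hX' hY' hZ' hU' eW eX eY eZ eU]
  exact covDerivCurvature_congr hD hW' hX' hY' hZ' hU' hW hX hY hZ hU (by simp [eW.self_of_nhds])
    (by simp [eX.self_of_nhds])
    (by simp [eY.self_of_nhds]) (by simp [eZ.self_of_nhds]) (by simp [eU.self_of_nhds])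

end Germs

/-! ### Linear algebra of curvature-like tensors and their traces -/

section Algebra

variable {V : Type*} [NormedAddCommGroup V] [InnerProductSpace ℝ V]

/-- Quadrilinear functions with the symmetries of a curvature tensor. -/
structure IsAlgebraicCurvature {V : Type*} [AddCommGroup V] [Module ℝ V]
    (R : V → V → V → V → ℝ) : Prop where
  add₁ : ∀ x x' y z u, R (x + x') y z u = R x y z u + R x' y z u
  smul₁ : ∀ (c : ℝ) x y z u, R (c • x) y z u = c * R x y z u
  swap_left : ∀ x y z u, R x y z u = -R y x z u
  swap_right : ∀ x y z u, R x y z u = -R x y u z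
  pair_symm : ∀ x y z u, R x y z u = R z u x y

namespace IsAlgebraicCurvature

variable {R : V → V → V → V → ℝ} (h : IsAlgebraicCurvature R)
include h

theorem add₂ (x y y' z u : V) : R x (y + y') z u = R x y z u + R x y' z u := by
  rw [h.swap_left, h.add₁, h.swap_left y, h.swap_left y']; ring

theorem add₃ (x y z z' u : V) : R x y (z + z') u = R x y z u + R x y z' u := by
  rw [h.pair_symm, h.add₁, h.pair_symm z, h.pair_symm z']

theorem add₄ (x y z u u' : V) : R x y z (u + u') = R x y z u + R x y z u' := by
  rw [h.swap_right, h.add₃, h.swap_right x y u, h.swap_right x y u']; ring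

theorem smul₂ (c : ℝ) (x y z u : V) : R x (c • y) z u = c * R x y z u := by
  rw [h.swap_left, h.smul₁, h.swap_left y]; ring

theorem smul₃ (c : ℝ) (x y z u : V) : R x y (c • z) u = c * R x y z u := by
  rw [h.pair_symm, h.smul₁, h.pair_symm z]

theorem smul₄ (c : ℝ) (x y z u : V) : R x y z (c • u) = c * R x y z u := by
  rw [h.swap_right, h.smul₃, h.swap_right x y u]; ring

theorem self_left (x z u : V) : R x x z u = 0 := by
  linarith [h.swap_left x x z u]

theorem self_right (x y z : V) : R x y z z = 0 := by
  linarith [h.swap_right x y z z]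

/-- The function `(x, u) ↦ R(x, y, z, u)` as a bilinear map. -/
def outer (y z : V) : V →ₗ[ℝ] V →ₗ[ℝ] ℝ :=
  LinearMap.mk₂ ℝ (fun x u ↦ R x y z u) (fun _ _ _ ↦ h.add₁ _ _ _ _ _)
    (fun _ _ _ ↦ h.smul₁ _ _ _ _ _) (fun _ _ _ ↦ h.add₄ _ _ _ _ _)
    (fun _ _ _ ↦ h.smul₄ _ _ _ _ _)

/-- The function `(y, z) ↦ R(x, y, z, u)` as a bilinear map. -/
def middle (x u : V) : V →ₗ[ℝ] V →ₗ[ℝ] ℝ :=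
  LinearMap.mk₂ ℝ (fun y z ↦ R x y z u) (fun _ _ _ ↦ h.add₂ _ _ _ _ _)
    (fun _ _ _ ↦ h.smul₂ _ _ _ _ _) (fun _ _ _ ↦ h.add₃ _ _ _ _ _)
    (fun _ _ _ ↦ h.smul₃ _ _ _ _ _)

end IsAlgebraicCurvature

/-- Expand each `e i` in the basis `f`; Parseval for `e` reduces the coefficient sums to Kronecker
deltas. -/
theorem sum_bilin_orthonormalBasis {ι ι' : Type*} [Fintype ι] [Fintype ι']
    (B : V →ₗ[ℝ] V →ₗ[ℝ] ℝ) (e : OrthonormalBasis ι ℝ V) (f : OrthonormalBasis ι' ℝ V) :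
    ∑ i, B (e i) (e i) = ∑ i, B (f i) (f i) := by
  classical
  have he : ∀ i, B (e i) (e i) =
      ∑ k, ∑ l, (⟪f k, e i⟫_ℝ * ⟪e i, f l⟫_ℝ) * B (f k) (f l) := by
    intro i
    conv_lhs => rw [← f.sum_repr' (e i)]
    simp only [map_sum, map_smul, LinearMap.sum_apply, LinearMap.smul_apply, smul_eq_mul,
      Finset.mul_sum]
    rw [Finset.sum_comm]
    refine Finset.sum_congr rfl fun k _ ↦ Finset.sum_congr rfl fun l _ ↦ ?_
    rw [real_inner_comm (e i) (f l)]
    ring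
  simp_rw [he]
  rw [Finset.sum_comm]
  refine Finset.sum_congr rfl fun k _ ↦ ?_
  rw [Finset.sum_comm]
  simp_rw [← Finset.sum_mul, e.sum_inner_mul_inner, orthonormal_iff_ite.1 f.orthonormal]
  simp

theorem IsAlgebraicCurvature.trace_eq {R : V → V → V → V → ℝ} (h : IsAlgebraicCurvature R)
    {ι ι' : Type*} [Fintype ι] [Fintype ι'] (e : OrthonormalBasis ι ℝ V)
    (f : OrthonormalBasis ι' ℝ V) :
    ∑ i, ∑ j, R (e i) (e j) (e j) (e i) = ∑ i, ∑ j, R (f i) (f j) (f j) (f i) := by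
  have h1 : ∀ i, ∑ j, R (e i) (e j) (e j) (e i) = ∑ j, R (e i) (f j) (f j) (e i) := fun i ↦
    sum_bilin_orthonormalBasis (h.middle (e i) (e i)) e f
  have h2 : ∀ j, ∑ i, R (e i) (f j) (f j) (e i) = ∑ i, R (f i) (f j) (f j) (f i) := fun j ↦
    sum_bilin_orthonormalBasis (h.outer (f j) (f j)) e f
  simp_rw [h1]
  rw [Finset.sum_comm]
  simp_rw [h2]
  rw [Finset.sum_comm]

section

variable {T : V → V → V → V → V → ℝ} (hT : ∀ w, IsAlgebraicCurvature (T w))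
  (hb : ∀ w x y z u, T w x y z u + T x y w z u + T y w x z u = 0)
include hT hb

/-- No linearity in the direction of differentiation is assumed: the second Bianchi identity moves
`w` into curvature slots, where linearity is known. -/
theorem bianchi_add (w w' x y z u : V) :
    T (w + w') x y z u = T w x y z u + T w' x y z u := by
  linarith [hb (w + w') x y z u, hb w x y z u, hb w' x y z u, (hT x).add₂ y w w' z u,
    (hT y).add₁ w w' x z u]

theorem bianchi_smul (c : ℝ) (w x y z u : V) : T (c • w) x y z u = c * T w x y z u := by
  linear_combination hb (c • w) x y z u - c * hb w x y z u - (hT x).smul₂ c y w z u -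
    (hT y).smul₁ c w x z u

/-- An identity known for orthonormal pairs extends to all pairs of vectors. -/
theorem sectional_eq_of_orthonormal (η : V →ₗ[ℝ] ℝ) (k : ℝ)
    (hη : ∀ x y, ‖x‖ = 1 → ‖y‖ = 1 → ⟪x, y⟫_ℝ = 0 → T x x y y x = k * η x) (x y : V) :
    T x x y y x = k * η x * (⟪x, x⟫_ℝ * ⟪y, y⟫_ℝ - ⟪x, y⟫_ℝ ^ 2) := by
  by_cases hx : x = 0
  · have := (hT x).smul₁ 0 0 y y x
    rw [zero_smul, zero_mul] at this
    subst hx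
    simp [this]
  have hx2 : ⟪x, x⟫_ℝ ≠ 0 := inner_self_ne_zero.2 hx
  -- Gram-Schmidt on the pair: the component of `y` along `x` changes neither side, by antisymmetry
  -- on the left and invariance of the Gram determinant on the right.
  obtain ⟨c, y', hxy, rfl⟩ : ∃ (c : ℝ) (y' : V), ⟪x, y'⟫_ℝ = 0 ∧ y = y' + c • x := by
    refine ⟨⟪x, y⟫_ℝ / ⟪x, x⟫_ℝ, y - (⟪x, y⟫_ℝ / ⟪x, x⟫_ℝ) • x, ?_, by simp⟩
    rw [inner_sub_right, inner_smul_right]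
    field_simp
    ring
  have h1 : T x x (y' + c • x) (y' + c • x) x = T x x y' y' x := by
    simp only [(hT x).add₂, (hT x).add₃, (hT x).smul₂, (hT x).smul₃, (hT x).self_left,
      (hT x).self_right]
    ring
  have hyx : ⟪y', x⟫_ℝ = 0 := by rw [real_inner_comm, hxy]
  have h2 : ⟪x, x⟫_ℝ * ⟪y' + c • x, y' + c • x⟫_ℝ - ⟪x, y' + c • x⟫_ℝ ^ 2 =
      ⟪x, x⟫_ℝ * ⟪y', y'⟫_ℝ := by
    simp only [inner_add_left, inner_add_right, inner_smul_left, inner_smul_right, hxy, hyx,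
      conj_trivial]
    ring
  rw [h1, h2]
  by_cases hy : y' = 0
  · have := (hT x).smul₂ 0 x 0 y' x
    rw [zero_smul, zero_mul] at this
    subst hy
    simp [this]
  have hnx : ‖x‖ ≠ 0 := norm_ne_zero_iff.2 hx
  have hny : ‖y'‖ ≠ 0 := norm_ne_zero_iff.2 hy
  have h3 := hη (‖x‖⁻¹ • x) (‖y'‖⁻¹ • y') (by simp [norm_smul, hnx]) (by simp [norm_smul, hny])
    (by simp [inner_smul_left, inner_smul_right, hxy])
  simp only [bianchi_smul hT hb, (hT x).smul₁, (hT x).smul₂, (hT x).smul₃, (hT x).smul₄, map_smul,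
    smul_eq_mul] at h3
  rw [real_inner_self_eq_norm_sq, real_inner_self_eq_norm_sq]
  field_simp at h3
  linear_combination h3

/-- The contracted second Bianchi identity, without metric contractions of the derivative. -/
theorem contracted_bianchi {ι : Type*} [Fintype ι] (e : ι → V) (w : V) :
    ∑ i, ∑ j, T w (e i) (e j) (e j) (e i) = 2 * ∑ i, ∑ j, T (e i) w (e j) (e j) (e i) := by
  -- Bianchi on `w, e i, e j` yields two terms that differ by exchanging `i` and `j`, hence the
  -- factor 2 after summation.
  have h1 : ∀ i j, T w (e i) (e j) (e j) (e i) =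
      T (e i) w (e j) (e j) (e i) + T (e j) w (e i) (e i) (e j) := by
    intro i j
    linarith [hb w (e i) (e j) (e j) (e i), (hT (e i)).swap_left (e j) w (e j) (e i),
      (hT (e j)).swap_right w (e i) (e j) (e i)]
  simp_rw [h1, Finset.sum_add_distrib]
  rw [Finset.sum_comm (f := fun i j ↦ T (e j) w (e i) (e i) (e j))]
  ring

/-- If the sectional forms are `k η`, then the trace of the derivative of the curvature is a
multiple of `η`. -/
theorem two_mul_trace_eq {n : ℕ} (e : OrthonormalBasis (Fin n) ℝ V) (η : V →ₗ[ℝ] ℝ) (k : ℝ)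
    (hη : ∀ x y, ‖x‖ = 1 → ‖y‖ = 1 → ⟪x, y⟫_ℝ = 0 → T x x y y x = k * η x) (w : V) :
    2 * ∑ i, ∑ j, T w (e i) (e j) (e j) (e i) = ((n : ℝ) - 1) * ((n : ℝ) + 2) * k * η w := by
  -- `C w` is the derivative of the Ricci tensor in direction `w`, a symmetric bilinear form.
  let C : V → V → V → ℝ := fun w x x' ↦ ∑ j, T w x (e j) (e j) x'
  have hC1 : ∀ w w' x x', C (w + w') x x' = C w x x' + C w' x x' := fun w w' x x' ↦ by
    simp only [C, bianchi_add hT hb, Finset.sum_add_distrib]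
  have hC2 : ∀ w x y x', C w (x + y) x' = C w x x' + C w y x' := fun w x y x' ↦ by
    simp only [C, (hT w).add₁, Finset.sum_add_distrib]
  have hC3 : ∀ w x y x', C w x' (x + y) = C w x' x + C w x' y := fun w x y x' ↦ by
    simp only [C, (hT w).add₄, Finset.sum_add_distrib]
  have hCs : ∀ w x x', C w x x' = C w x' x := fun w x x' ↦ by
    refine Finset.sum_congr rfl fun j _ ↦ ?_
    rw [(hT w).pair_symm, (hT w).swap_left, (hT w).swap_right, neg_neg]
  have hcube : ∀ x, C x x x = ((n : ℝ) - 1) * k * η x * ⟪x, x⟫_ℝ := fun x ↦ by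
    have hsq : ∑ j, ⟪x, e j⟫_ℝ ^ 2 = ⟪x, x⟫_ℝ := by
      rw [← e.sum_inner_mul_inner x x]
      exact Finset.sum_congr rfl fun j _ ↦ by rw [sq, real_inner_comm x (e j)]
    simp only [C, sectional_eq_of_orthonormal hT hb η k hη, ← Finset.mul_sum,
      Finset.sum_sub_distrib, hsq, orthonormal_iff_ite.1 e.orthonormal]
    simp
    ring
  -- Polarization of the cubic identity `hcube`: its part linear in `w` at `v + w` is half the
  -- difference of the values at `v + w` and `v - w`, less the value at `w`.
  have hpol : ∀ v, ⟪v, v⟫_ℝ = 1 → C w v v + 2 * C v v w =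
      ((n : ℝ) - 1) * k * (η w + 2 * (⟪w, v⟫_ℝ * η v)) := fun v hv ↦ by
    have h1 := hcube (v + w)
    have h2 := hcube (v + -w)
    have h3 := hcube w
    have hvw := real_inner_comm v w
    have a1 : ∀ a b, C (-w) a b = -C w a b := fun a b ↦ by
      simp only [C, ← Finset.sum_neg_distrib]
      refine Finset.sum_congr rfl fun j _ ↦ ?_
      rw [← neg_one_smul ℝ w, bianchi_smul hT hb]; ring
    have a2 : ∀ a b, C a (-w) b = -C a w b := fun a b ↦ by
      simp only [C, ← Finset.sum_neg_distrib]
      refine Finset.sum_congr rfl fun j _ ↦ ?_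
      rw [← neg_one_smul ℝ w, (hT a).smul₁]; ring
    have a3 : ∀ a b, C a b (-w) = -C a b w := fun a b ↦ by
      rw [hCs, a2, hCs]
    simp only [hC1, hC2, hC3, a1, a2, a3, map_add, map_neg, inner_add_left, inner_add_right,
      inner_neg_left, inner_neg_right, hv, hvw] at h1 h2
    have s1 := hCs v w v
    linear_combination (h1 - h2 - 2 * h3) / 2 - s1 -
      2 * (n - 1) * k * η v * hvw
  -- The factor `n + 2` arises here: `η w` is summed `n` times and `2⟪w, e i⟫ η(e i)` sums to `2 η
  -- w`. By the contracted Bianchi identity the two sums on the left are equal, giving twice the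
  -- trace.
  have hsum : ∑ i, (C w (e i) (e i) + 2 * C (e i) (e i) w) =
      ((n : ℝ) - 1) * k * (n * η w + 2 * η w) := by
    have hη2 : ∑ i, ⟪w, e i⟫_ℝ * η (e i) = η w := by
      conv_rhs => rw [← e.sum_repr' w]
      simp [map_sum, real_inner_comm]
    rw [Finset.sum_congr rfl fun i _ ↦ hpol (e i)
      (by simp), ← Finset.mul_sum, Finset.sum_add_distrib, ← Finset.mul_sum, hη2]
    simp
  have hcontr := contracted_bianchi hT hb e w
  have hS : ∑ i, C (e i) (e i) w = ∑ i, ∑ j, T (e i) w (e j) (e j) (e i) := by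
    refine Finset.sum_congr rfl fun i _ ↦ ?_
    rw [hCs]
  rw [Finset.sum_add_distrib, ← Finset.mul_sum, hS] at hsum
  linear_combination hcontr + hsum

end

end Algebra

/-! ### Orthonormal frames, smoothness and differential of the scalar curvature -/

section ScalarCurvature

variable [RiemannianBundle (fun p : M ↦ TangentSpace (𝓡 n) p)]

/-- Infinitesimal form of the basis independence of a trace: `w` is an infinitesimal rotation of
`e`. It will remove the terms containing derivatives of a frame. -/
theorem sum_bilin_skew {V : Type*} [NormedAddCommGroup V] [InnerProductSpace ℝ V]
    {ι : Type*} [Fintype ι] (B : V →ₗ[ℝ] V →ₗ[ℝ] ℝ) (e : OrthonormalBasis ι ℝ V) (w : ι → V)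
    (hw : ∀ a b, ⟪w a, e b⟫_ℝ + ⟪e a, w b⟫_ℝ = 0) :
    ∑ a, (B (w a) (e a) + B (e a) (w a)) = 0 := by
  have h1 : ∀ a, B (w a) (e a) = ∑ c, ⟪e c, w a⟫_ℝ * B (e c) (e a) := fun a ↦ by
    conv_lhs => rw [← e.sum_repr' (w a)]
    simp [map_sum, LinearMap.sum_apply]
  have h2 : ∀ a, B (e a) (w a) = ∑ c, ⟪e c, w a⟫_ℝ * B (e a) (e c) := fun a ↦ by
    conv_lhs => rw [← e.sum_repr' (w a)]
    simp [map_sum]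
  simp_rw [Finset.sum_add_distrib, h1, h2]
  rw [Finset.sum_comm, ← Finset.sum_add_distrib]
  refine Finset.sum_eq_zero fun a _ ↦ ?_
  rw [← Finset.sum_add_distrib]
  refine Finset.sum_eq_zero fun c _ ↦ ?_
  have := hw a c
  rw [real_inner_comm] at this
  linear_combination B (e a) (e c) * this

/-- An orthonormal family of `n` tangent vectors as an orthonormal basis. -/
def tangentOrthonormalBasis {q : M} {v : Fin n → TangentSpace (𝓡 n) q} (hv : Orthonormal ℝ v) :
    OrthonormalBasis (Fin n) ℝ (TangentSpace (𝓡 n) q) :=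
  OrthonormalBasis.mk hv (by
    have hf : Module.finrank ℝ (TangentSpace (𝓡 n) q) = n :=
      finrank_euclideanSpace_fin (𝕜 := ℝ) (n := n)
    exact (hv.linearIndependent.span_eq_top_of_card_eq_finrank' (by simp [hf])).ge)

theorem tangentOrthonormalBasis_apply {q : M} {v : Fin n → TangentSpace (𝓡 n) q}
    (hv : Orthonormal ℝ v) (i : Fin n) : tangentOrthonormalBasis hv i = v i := by
  simp [tangentOrthonormalBasis]

variable [IsContMDiffRiemannianBundle (𝓡 n) ∞ (EuclideanSpace ℝ (Fin n))
    (fun p : M ↦ TangentSpace (𝓡 n) p)]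

/-- The Gram-Schmidt recursion only divides by squared norms of earlier vectors, nonzero by linear
independence. -/
theorem contMDiffOn_gramSchmidt {u : Set M} {s : Fin n → ∀ q : M, TangentSpace (𝓡 n) q}
    (hs : ∀ i, ContMDiffOn (𝓡 n) ((𝓡 n).prod 𝓘(ℝ, EuclideanSpace ℝ (Fin n))) ∞
      (fun q ↦ TotalSpace.mk' (EuclideanSpace ℝ (Fin n)) q (s i q)) u)
    (hli : ∀ q ∈ u, LinearIndependent ℝ (fun i ↦ s i q)) (i : Fin n) :
    ContMDiffOn (𝓡 n) ((𝓡 n).prod 𝓘(ℝ, EuclideanSpace ℝ (Fin n))) ∞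
      (fun q ↦ TotalSpace.mk' (EuclideanSpace ℝ (Fin n)) q
        (InnerProductSpace.gramSchmidt ℝ (fun j ↦ s j q) i)) u := by
  induction i using WellFoundedLT.induction with
  | ind i ih =>
    let c : Fin n → M → ℝ := fun j q ↦
      ⟪InnerProductSpace.gramSchmidt ℝ (fun j ↦ s j q) j, s i q⟫_ℝ *
      (⟪InnerProductSpace.gramSchmidt ℝ (fun j ↦ s j q) j,
        InnerProductSpace.gramSchmidt ℝ (fun j ↦ s j q) j⟫_ℝ)⁻¹
    have hc : ∀ j ∈ Finset.Iio i, ContMDiffOn (𝓡 n) 𝓘(ℝ, ℝ) ∞ (c j) u := fun j hj ↦ by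
      have hj := ih j (Finset.mem_Iio.1 hj)
      refine ContMDiffOn.mul (hj.inner_bundle (hs i)) (ContMDiffOn.inv₀ (hj.inner_bundle hj) ?_)
      exact fun q hq ↦ inner_self_ne_zero.2
        (InnerProductSpace.gramSchmidt_ne_zero j (hli q hq))
    have hsum := ContMDiffOn.sub_section (hs i) (ContMDiffOn.sum_section (s := Finset.Iio i)
      fun j hj ↦ (hc j hj).smul_section (ih j (Finset.mem_Iio.1 hj)))
    refine hsum.congr fun q hq ↦ ?_
    rw [InnerProductSpace.gramSchmidt_def]
    simp only [Submodule.starProjection_singleton, Pi.sub_apply, Pi.smul_apply', c,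
      real_inner_self_eq_norm_sq, div_eq_mul_inv, RCLike.ofReal_real_eq_id, id]

/-- Around each point there are smooth fields which form an orthonormal frame near the point. -/
theorem exists_orthonormal_frame [T2Space M] (p : M) :
    ∃ E : Fin n → ∀ q : M, TangentSpace (𝓡 n) q, (∀ a, IsSmoothField (E a)) ∧
      ∀ᶠ q in 𝓝 p, Orthonormal ℝ (fun a ↦ E a q) := by
  let e := trivializationAt (EuclideanSpace ℝ (Fin n)) (TangentSpace (𝓡 n) : M → Type _) p
  let b := (EuclideanSpace.basisFun (Fin n) ℝ).toBasis
  let s := e.localFrame b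
  have hfr := e.isLocalFrameOn_localFrame_baseSet (𝓡 n) ∞ b
  have hG := contMDiffOn_gramSchmidt hfr.contMDiffOn fun q hq ↦ hfr.linearIndependent hq
  have hN : ∀ i, ContMDiffOn (𝓡 n) ((𝓡 n).prod 𝓘(ℝ, EuclideanSpace ℝ (Fin n))) ∞
      (fun q ↦ TotalSpace.mk' (EuclideanSpace ℝ (Fin n)) q
        (InnerProductSpace.gramSchmidtNormed ℝ (fun j ↦ s j q) i)) e.baseSet := fun i ↦ by
    have h1 : ContMDiffOn (𝓡 n) 𝓘(ℝ, ℝ) ∞ (fun q ↦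
        (√⟪InnerProductSpace.gramSchmidt ℝ (fun j ↦ s j q) i,
          InnerProductSpace.gramSchmidt ℝ (fun j ↦ s j q) i⟫_ℝ)⁻¹) e.baseSet := by
      intro q hq
      have hne := InnerProductSpace.gramSchmidt_ne_zero (𝕜 := ℝ) i (hfr.linearIndependent hq)
      have hne2 : ⟪InnerProductSpace.gramSchmidt ℝ (fun j ↦ s j q) i,
          InnerProductSpace.gramSchmidt ℝ (fun j ↦ s j q) i⟫_ℝ ≠ 0 := inner_self_ne_zero.2 hne
      refine ContMDiffWithinAt.inv₀ ?_ ?_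
      · exact ContDiffAt.comp_contMDiffWithinAt (g := Real.sqrt)
          (f := fun q ↦ ⟪InnerProductSpace.gramSchmidt ℝ (fun j ↦ s j q) i,
            InnerProductSpace.gramSchmidt ℝ (fun j ↦ s j q) i⟫_ℝ)
          (Real.contDiffAt_sqrt hne2) (((hG i).inner_bundle (hG i)) q hq)
      · rw [← norm_eq_sqrt_real_inner]
        exact norm_ne_zero_iff.2 hne
    refine (h1.smul_section (hG i)).congr fun q hq ↦ ?_
    simp only [InnerProductSpace.gramSchmidtNormed, Pi.smul_apply', ← norm_eq_sqrt_real_inner]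
    rfl
  have hb : e.baseSet ∈ 𝓝 p :=
    e.open_baseSet.mem_nhds (FiberBundle.mem_baseSet_trivializationAt' p)
  choose E hE hEe using fun i ↦ exists_isSmoothField_eventuallyEq hb (hN i)
  refine ⟨E, hE, ?_⟩
  filter_upwards [hb, Filter.eventually_all.2 hEe] with q hq h
  simp_rw [h]
  exact InnerProductSpace.gramSchmidtNormed_orthonormal (hfr.linearIndependent hq)

variable [T2Space M] {D : TangentConnection n M}

theorem isAlgebraicCurvature_curvatureAt (hD : IsLeviCivita D) (p : M) :
    IsAlgebraicCurvature (curvatureAt D p) := by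
  constructor
  · intro x x' y z u
    obtain ⟨X, hX, rfl⟩ := exists_isSmoothField_apply x
    obtain ⟨X', hX', rfl⟩ := exists_isSmoothField_apply x'
    obtain ⟨Y, hY, rfl⟩ := exists_isSmoothField_apply y
    obtain ⟨Z, hZ, rfl⟩ := exists_isSmoothField_apply z
    obtain ⟨U, hU, rfl⟩ := exists_isSmoothField_apply u
    have := curvatureAt_eq hD (hX.add hX') hY hZ hU p
    rw [Pi.add_apply] at this
    rw [this, curvatureAt_eq hD hX hY hZ hU, curvatureAt_eq hD hX' hY hZ hU,
      curvature_add_left hD hX hX' hZ]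
  · intro c x y z u
    obtain ⟨X, hX, rfl⟩ := exists_isSmoothField_apply x
    obtain ⟨Y, hY, rfl⟩ := exists_isSmoothField_apply y
    obtain ⟨Z, hZ, rfl⟩ := exists_isSmoothField_apply z
    obtain ⟨U, hU, rfl⟩ := exists_isSmoothField_apply u
    have hc : IsSmoothFun (n := n) (fun _ : M ↦ c) := contMDiff_const
    have := curvatureAt_eq hD (hX.smul hc) hY hZ hU p
    rw [Pi.smul_apply'] at this
    rw [this, curvatureAt_eq hD hX hY hZ hU, curvature_smul_left hD hc hX hZ]
  · intro x y z u
    obtain ⟨X, hX, rfl⟩ := exists_isSmoothField_apply x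
    obtain ⟨Y, hY, rfl⟩ := exists_isSmoothField_apply y
    obtain ⟨Z, hZ, rfl⟩ := exists_isSmoothField_apply z
    obtain ⟨U, hU, rfl⟩ := exists_isSmoothField_apply u
    rw [curvatureAt_eq hD hX hY hZ hU, curvatureAt_eq hD hY hX hZ hU, curvature_swap_left,
      Pi.neg_apply]
  · intro x y z u
    obtain ⟨X, hX, rfl⟩ := exists_isSmoothField_apply x
    obtain ⟨Y, hY, rfl⟩ := exists_isSmoothField_apply y
    obtain ⟨Z, hZ, rfl⟩ := exists_isSmoothField_apply z
    obtain ⟨U, hU, rfl⟩ := exists_isSmoothField_apply u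
    rw [curvatureAt_eq hD hX hY hZ hU, curvatureAt_eq hD hX hY hU hZ,
      curvature_swap_right hD hX hY hZ hU, Pi.neg_apply]
  · intro x y z u
    obtain ⟨X, hX, rfl⟩ := exists_isSmoothField_apply x
    obtain ⟨Y, hY, rfl⟩ := exists_isSmoothField_apply y
    obtain ⟨Z, hZ, rfl⟩ := exists_isSmoothField_apply z
    obtain ⟨U, hU, rfl⟩ := exists_isSmoothField_apply u
    rw [curvatureAt_eq hD hX hY hZ hU, curvatureAt_eq hD hZ hU hX hY,
      curvature_pair_symm hD hX hY hZ hU]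

theorem isAlgebraicCurvature_covDerivCurvatureAt (hD : IsLeviCivita D) (p : M)
    (w : TangentSpace (𝓡 n) p) : IsAlgebraicCurvature (covDerivCurvatureAt D p w) := by
  obtain ⟨W, hW, rfl⟩ := exists_isSmoothField_apply w
  constructor
  · intro x x' y z u
    obtain ⟨X, hX, rfl⟩ := exists_isSmoothField_apply x
    obtain ⟨X', hX', rfl⟩ := exists_isSmoothField_apply x'
    obtain ⟨Y, hY, rfl⟩ := exists_isSmoothField_apply y
    obtain ⟨Z, hZ, rfl⟩ := exists_isSmoothField_apply z
    obtain ⟨U, hU, rfl⟩ := exists_isSmoothField_apply u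
    have := covDerivCurvatureAt_eq hD hW (hX.add hX') hY hZ hU p
    rw [Pi.add_apply] at this
    rw [this, covDerivCurvatureAt_eq hD hW hX hY hZ hU, covDerivCurvatureAt_eq hD hW hX' hY hZ hU,
      covDerivCurvature_add_left hD hW hX hX' hY hZ hU]
  · intro c x y z u
    obtain ⟨X, hX, rfl⟩ := exists_isSmoothField_apply x
    obtain ⟨Y, hY, rfl⟩ := exists_isSmoothField_apply y
    obtain ⟨Z, hZ, rfl⟩ := exists_isSmoothField_apply z
    obtain ⟨U, hU, rfl⟩ := exists_isSmoothField_apply u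
    have hc : IsSmoothFun (n := n) (fun _ : M ↦ c) := contMDiff_const
    have := covDerivCurvatureAt_eq hD hW (hX.smul hc) hY hZ hU p
    rw [Pi.smul_apply'] at this
    rw [this, covDerivCurvatureAt_eq hD hW hX hY hZ hU,
      covDerivCurvature_smul_left hD hW hc hX hY hZ hU]
  · intro x y z u
    obtain ⟨X, hX, rfl⟩ := exists_isSmoothField_apply x
    obtain ⟨Y, hY, rfl⟩ := exists_isSmoothField_apply y
    obtain ⟨Z, hZ, rfl⟩ := exists_isSmoothField_apply z
    obtain ⟨U, hU, rfl⟩ := exists_isSmoothField_apply u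
    rw [covDerivCurvatureAt_eq hD hW hX hY hZ hU, covDerivCurvatureAt_eq hD hW hY hX hZ hU,
      covDerivCurvature_swap_left]
  · intro x y z u
    obtain ⟨X, hX, rfl⟩ := exists_isSmoothField_apply x
    obtain ⟨Y, hY, rfl⟩ := exists_isSmoothField_apply y
    obtain ⟨Z, hZ, rfl⟩ := exists_isSmoothField_apply z
    obtain ⟨U, hU, rfl⟩ := exists_isSmoothField_apply u
    rw [covDerivCurvatureAt_eq hD hW hX hY hZ hU, covDerivCurvatureAt_eq hD hW hX hY hU hZ,
      covDerivCurvature_swap_right hD hW hX hY hZ hU]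
  · intro x y z u
    obtain ⟨X, hX, rfl⟩ := exists_isSmoothField_apply x
    obtain ⟨Y, hY, rfl⟩ := exists_isSmoothField_apply y
    obtain ⟨Z, hZ, rfl⟩ := exists_isSmoothField_apply z
    obtain ⟨U, hU, rfl⟩ := exists_isSmoothField_apply u
    rw [covDerivCurvatureAt_eq hD hW hX hY hZ hU, covDerivCurvatureAt_eq hD hW hZ hU hX hY,
      covDerivCurvature_pair_symm hD hW hX hY hZ hU]

theorem covDerivCurvatureAt_bianchi (hD : IsLeviCivita D) (p : M)
    (w x y z u : TangentSpace (𝓡 n) p) :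
    covDerivCurvatureAt D p w x y z u + covDerivCurvatureAt D p x y w z u
      + covDerivCurvatureAt D p y w x z u = 0 := by
  obtain ⟨W, hW, rfl⟩ := exists_isSmoothField_apply w
  obtain ⟨X, hX, rfl⟩ := exists_isSmoothField_apply x
  obtain ⟨Y, hY, rfl⟩ := exists_isSmoothField_apply y
  obtain ⟨Z, hZ, rfl⟩ := exists_isSmoothField_apply z
  obtain ⟨U, hU, rfl⟩ := exists_isSmoothField_apply u
  rw [covDerivCurvatureAt_eq hD hW hX hY hZ hU, covDerivCurvatureAt_eq hD hX hY hW hZ hU,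
    covDerivCurvatureAt_eq hD hY hW hX hZ hU, covDerivCurvature_bianchi hD hW hX hY hZ hU]

theorem scalarCurvature_eq_sum (hD : IsLeviCivita D) {p : M} {ι : Type*} [Fintype ι]
    (e : OrthonormalBasis ι ℝ (TangentSpace (𝓡 n) p)) :
    scalarCurvature D p = ∑ i, ∑ j, curvatureAt D p (e i) (e j) (e j) (e i) :=
  (isAlgebraicCurvature_curvatureAt hD p).trace_eq _ e

/-- `scalarCurvature` picks a basis at each point with no continuity in the point; independence of
the basis allows a smooth frame instead, which gives smoothness and a way to differentiate. -/
theorem scalarCurvature_eventuallyEq (hD : IsLeviCivita D) {p : M}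
    {E : Fin n → ∀ q : M, TangentSpace (𝓡 n) q} (hE : ∀ a, IsSmoothField (E a))
    (hon : ∀ᶠ q in 𝓝 p, Orthonormal ℝ (fun a ↦ E a q)) :
    scalarCurvature D =ᶠ[𝓝 p]
      fun q ↦ ∑ i, ∑ j, curvature D (E i) (E j) (E j) (E i) q := by
  filter_upwards [hon] with q hq
  rw [scalarCurvature_eq_sum hD (tangentOrthonormalBasis hq)]
  simp only [tangentOrthonormalBasis_apply, curvatureAt_eq hD (hE _) (hE _) (hE _) (hE _)]

theorem isSmoothFun_scalarCurvature (hD : IsLeviCivita D) :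
    IsSmoothFun (n := n) (scalarCurvature D) := by
  intro p
  obtain ⟨E, hE, hon⟩ := exists_orthonormal_frame (n := n) p
  refine ContMDiffAt.congr_of_eventuallyEq ?_ (scalarCurvature_eventuallyEq hD hE hon)
  refine ContMDiffAt.sum fun i _ ↦ ContMDiffAt.sum fun j _ ↦ ?_
  exact (hE i).curvature hD (hE j) (hE j) (hE i) p

theorem dirDeriv_sum {ι : Type*} (s : Finset ι) (f : ι → M → ℝ)
    (hf : ∀ i, IsSmoothFun (n := n) (f i)) (X : ∀ p : M, TangentSpace (𝓡 n) p) (p : M) :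
    IsSmoothFun (n := n) (fun q ↦ ∑ i ∈ s, f i q) ∧
    dirDeriv X (fun q ↦ ∑ i ∈ s, f i q) p = ∑ i ∈ s, dirDeriv X (f i) p := by
  classical
  refine ⟨fun q ↦ ContMDiffAt.sum fun i _ ↦ hf i q, ?_⟩
  induction s using Finset.induction_on with
  | empty => simp [dirDeriv, mvfderiv_const]
  | insert a s ha ih =>
    simp only [Finset.sum_insert ha]
    rw [dirDeriv_add (hf a) (fun q ↦ ContMDiffAt.sum fun i _ ↦ hf i q)]
    exact congrArg (dirDeriv X (f a) p + ·) ih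

/-- The scalar form is the trace of the covariant derivative of the curvature. -/
theorem exists_scalarForm_eq_sum (hD : IsLeviCivita D) (p : M) :
    ∃ e : OrthonormalBasis (Fin n) ℝ (TangentSpace (𝓡 n) p), ∀ w,
      scalarForm D p w = ∑ i, ∑ j, covDerivCurvatureAt D p w (e i) (e j) (e j) (e i) := by
  obtain ⟨E, hE, hon⟩ := exists_orthonormal_frame (n := n) p
  have hp := hon.self_of_nhds
  refine ⟨tangentOrthonormalBasis hp, fun w ↦ ?_⟩
  obtain ⟨W, hW, rfl⟩ := exists_isSmoothField_apply w
  have hR : ∀ i j, IsSmoothFun (n := n) (curvature D (E i) (E j) (E j) (E i)) := fun i j ↦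
    (hE i).curvature hD (hE j) (hE j) (hE i)
  have h1 : scalarForm D p (W p) =
      ∑ i, ∑ j, dirDeriv W (curvature D (E i) (E j) (E j) (E i)) p := by
    have heq := scalarCurvature_eventuallyEq hD hE hon
    have h : scalarForm D p (W p) =
        dirDeriv W (fun q ↦ ∑ i, ∑ j, curvature D (E i) (E j) (E j) (E i) q) p := by
      rw [scalarForm, dirDeriv, mvfderiv, mvfderiv, heq.mfderiv_eq, heq.self_of_nhds]
    rw [h, (dirDeriv_sum _ _ (fun i ↦ (dirDeriv_sum _ _ (hR i) W p).1) W p).2]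
    exact Finset.sum_congr rfl fun i _ ↦ (dirDeriv_sum _ _ (hR i) W p).2
  -- The products `⟪E a, E b⟫` are constant near `p`, so `E a ↦ ∇_W E a` is skew. The four
  -- correction terms in `∇R` then cancel in pairs, outer slots and middle slots, once summed.
  have hskew : ∀ a b, ⟪covField D W (E a) p, E b p⟫_ℝ + ⟪E a p, covField D W (E b) p⟫_ℝ = 0 := by
    intro a b
    rw [← congrFun (dirDeriv_inner (W := W) hD (hE a) (hE b)) p]
    have : (fun q ↦ ⟪E a q, E b q⟫_ℝ) =ᶠ[𝓝 p] fun _ ↦ if a = b then 1 else 0 := by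
      filter_upwards [hon] with q hq
      exact orthonormal_iff_ite.1 hq a b
    rw [dirDeriv, mvfderiv, this.mfderiv_eq, mfderiv_const]
    exact map_zero (NormedSpace.fromTangentSpace _)
  have hA := isAlgebraicCurvature_curvatureAt hD p
  have hcr1 : ∀ j, ∑ i, (curvatureAt D p (covField D W (E i) p) (E j p) (E j p) (E i p) +
      curvatureAt D p (E i p) (E j p) (E j p) (covField D W (E i) p)) = 0 := fun j ↦ by
    have := sum_bilin_skew (hA.outer (E j p) (E j p)) (tangentOrthonormalBasis hp)
      (fun a ↦ covField D W (E a) p) (by simpa [tangentOrthonormalBasis_apply] using hskew)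
    simp only [tangentOrthonormalBasis_apply] at this
    exact this
  have hcr2 : ∀ i, ∑ j, (curvatureAt D p (E i p) (covField D W (E j) p) (E j p) (E i p) +
      curvatureAt D p (E i p) (E j p) (covField D W (E j) p) (E i p)) = 0 := fun i ↦ by
    have := sum_bilin_skew (hA.middle (E i p) (E i p)) (tangentOrthonormalBasis hp)
      (fun a ↦ covField D W (E a) p) (by simpa [tangentOrthonormalBasis_apply] using hskew)
    simp only [tangentOrthonormalBasis_apply] at this
    exact this
  have hterm : ∀ i j, covDerivCurvatureAt D p (W p) (E i p) (E j p) (E j p) (E i p) =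
      dirDeriv W (curvature D (E i) (E j) (E j) (E i)) p
      - (curvatureAt D p (covField D W (E i) p) (E j p) (E j p) (E i p) +
          curvatureAt D p (E i p) (E j p) (E j p) (covField D W (E i) p))
      - (curvatureAt D p (E i p) (covField D W (E j) p) (E j p) (E i p) +
          curvatureAt D p (E i p) (E j p) (covField D W (E j) p) (E i p)) := fun i j ↦ by
    rw [covDerivCurvatureAt_eq hD hW (hE i) (hE j) (hE j) (hE i), covDerivCurvature_eq,
      curvatureAt_eq hD (hW.cov hD (hE i)) (hE j) (hE j) (hE i),
      curvatureAt_eq hD (hE i) (hE j) (hE j) (hW.cov hD (hE i)),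
      curvatureAt_eq hD (hE i) (hW.cov hD (hE j)) (hE j) (hE i),
      curvatureAt_eq hD (hE i) (hE j) (hW.cov hD (hE j)) (hE i)]
    ring
  simp only [tangentOrthonormalBasis_apply]
  simp_rw [hterm, Finset.sum_sub_distrib, hcr2]
  rw [Finset.sum_comm (f := fun i j ↦
    (curvatureAt D p (covField D W (E i) p) (E j p) (E j p) (E i p) +
          curvatureAt D p (E i p) (E j p) (E j p) (covField D W (E i) p)))]
  simp_rw [hcr1]
  simpa using h1

end ScalarCurvature

/-! ### Integral submanifolds of `ker dτ` as level sets -/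

section LevelSets

/-- A linear functional which is not zero is the first component of a linear isomorphism. -/
theorem exists_equiv_prod {n : ℕ} (L : EuclideanSpace ℝ (Fin n) →L[ℝ] ℝ) (hL : L ≠ 0) :
    ∃ (pr : EuclideanSpace ℝ (Fin n) →L[ℝ] EuclideanSpace ℝ (Fin (n - 1)))
      (e : EuclideanSpace ℝ (Fin n) ≃L[ℝ] ℝ × EuclideanSpace ℝ (Fin (n - 1))),
      (e : EuclideanSpace ℝ (Fin n) →L[ℝ] ℝ × EuclideanSpace ℝ (Fin (n - 1))) = L.prod pr := by
  -- A nonzero functional forces `n ≥ 1`, so the truncated `n - 1` is the true dimension of the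
  -- kernel.
  have hker : Module.finrank ℝ L.ker + 1 = n := by
    have h : (L : Module.Dual ℝ (EuclideanSpace ℝ (Fin n))) ≠ 0 := fun h ↦
      hL (by ext x; exact congrArg (fun f ↦ f x) h)
    have := Module.Dual.finrank_ker_add_one_of_ne_zero h
    rwa [finrank_euclideanSpace_fin] at this
  let a : L.ker ≃ₗ[ℝ] EuclideanSpace ℝ (Fin (n - 1)) :=
    LinearEquiv.ofFinrankEq _ _ (by rw [finrank_euclideanSpace_fin]; omega)
  let pr : EuclideanSpace ℝ (Fin n) →L[ℝ] EuclideanSpace ℝ (Fin (n - 1)) :=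
    (LinearMap.toContinuousLinearMap (a : L.ker →ₗ[ℝ] _)).comp L.ker.orthogonalProjectionOnto
  have hinj : Function.Injective (L.prod pr).toLinearMap := by
    rw [← LinearMap.ker_eq_bot, LinearMap.ker_eq_bot']
    intro x hx
    have h1 : L x = 0 := congrArg Prod.fst hx
    have h2 : pr x = 0 := congrArg Prod.snd hx
    have h3 : L.ker.orthogonalProjectionOnto x = 0 := by
      apply a.injective
      simpa [pr] using h2
    have h4 := Submodule.orthogonalProjectionOnto_mem_subspace_eq_self (K := L.ker) ⟨x, h1⟩
    rw [h3] at h4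
    exact (congrArg Subtype.val h4).symm
  let e := LinearEquiv.ofInjectiveOfFinrankEq
    (L.prod pr).toLinearMap hinj
    (by rw [Module.finrank_prod, finrank_euclideanSpace_fin, finrank_euclideanSpace_fin,
          Module.finrank_self]; omega)
  refine ⟨pr, e.toContinuousLinearEquiv, ?_⟩
  ext x <;> rfl

/-- A regular level set is parametrized near a given point by a smooth map with a smooth left
inverse. -/
theorem exists_levelSet_parametrization {n : ℕ} {h : EuclideanSpace ℝ (Fin n) → ℝ}
    {O : Set (EuclideanSpace ℝ (Fin n))} (hO : IsOpen O) (hh : ContDiffOn ℝ ∞ h O)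
    {x₀ : EuclideanSpace ℝ (Fin n)} (hx₀ : x₀ ∈ O) (hd : fderiv ℝ h x₀ ≠ 0) :
    ∃ (g : EuclideanSpace ℝ (Fin (n - 1)) → EuclideanSpace ℝ (Fin n))
      (r : EuclideanSpace ℝ (Fin n) → EuclideanSpace ℝ (Fin (n - 1))),
      ContDiff ℝ ∞ g ∧ (∀ s, g s ∈ O) ∧ (∀ s, h (g s) = h x₀) ∧ g 0 = x₀ ∧
      (∀ s, r (g s) = s) ∧ ∀ s, DifferentiableAt ℝ r (g s) := by
  obtain ⟨pr, e, he⟩ := exists_equiv_prod (fderiv ℝ h x₀) hd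
  let Φ : EuclideanSpace ℝ (Fin n) → ℝ × EuclideanSpace ℝ (Fin (n - 1)) := fun x ↦ (h x, pr x)
  have hhd : ∀ x ∈ O, ContDiffAt ℝ ∞ h x := fun x hx ↦ (hh x hx).contDiffAt (hO.mem_nhds hx)
  have hΦd : ∀ x ∈ O, ContDiffAt ℝ ∞ Φ x := fun x hx ↦ (hhd x hx).prodMk pr.contDiff.contDiffAt
  have hΦf : ∀ x ∈ O, HasFDerivAt Φ ((fderiv ℝ h x).prod pr) x := fun x hx ↦
    (((hhd x hx).differentiableAt (by simp)).hasFDerivAt).prodMk pr.hasFDerivAt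
  have hΦx₀ : HasFDerivAt Φ (e : EuclideanSpace ℝ (Fin n) →L[ℝ] _) x₀ := by
    rw [he]; exact hΦf x₀ hx₀
  let Ψ := (hΦd x₀ hx₀).toOpenPartialHomeomorph Φ hΦx₀ (by simp)
  have hΨ : ∀ x, Ψ x = Φ x := fun x ↦ rfl
  have hsrc : x₀ ∈ Ψ.source := ContDiffAt.mem_toOpenPartialHomeomorph_source _ _ _
  have hcont : ContinuousAt (fderiv ℝ Φ) x₀ := (hΦd x₀ hx₀).continuousAt_fderiv (by simp)
  -- The local inverse must be smooth at every parameter, not only at the base point; invertibility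
  -- of the derivative is an open condition.
  have hinv : ∀ᶠ x in 𝓝 x₀, ∃ e' : EuclideanSpace ℝ (Fin n) ≃L[ℝ] ℝ × EuclideanSpace ℝ (Fin (n - 1)),
      (e' : EuclideanSpace ℝ (Fin n) →L[ℝ] _) = fderiv ℝ Φ x := by
    have hmem := ContinuousLinearEquiv.nhds e
    rw [← hΦx₀.fderiv] at hmem
    exact hcont hmem
  have hgood : ∀ᶠ x in 𝓝 x₀, x ∈ O ∧ ∃ e' : EuclideanSpace ℝ (Fin n) ≃L[ℝ] ℝ × EuclideanSpace ℝ (Fin (n - 1)),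
      (e' : EuclideanSpace ℝ (Fin n) →L[ℝ] _) = fderiv ℝ Φ x :=
    (hO.eventually_mem hx₀).and hinv
  have hgood' : ∀ᶠ y in 𝓝 (Φ x₀), y ∈ Ψ.target ∧ Ψ.symm y ∈ O ∧
      ∃ e' : EuclideanSpace ℝ (Fin n) ≃L[ℝ] ℝ × EuclideanSpace ℝ (Fin (n - 1)),
      (e' : EuclideanSpace ℝ (Fin n) →L[ℝ] _) = fderiv ℝ Φ (Ψ.symm y) := by
    have ht : Φ x₀ ∈ Ψ.target := Ψ.map_source hsrc
    have hs := (Ψ.continuousAt_symm ht).tendsto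
    have hxx : Ψ.symm (Φ x₀) = x₀ := Ψ.left_inv hsrc
    rw [hxx] at hs
    exact (Ψ.open_target.eventually_mem ht).and (hs.eventually hgood)
  obtain ⟨ε, hε, hball⟩ := Metric.eventually_nhds_iff_ball.1 hgood'
  -- A diffeomorphism of the whole space onto a small ball, so the level set piece is parametrized
  -- by all of Euclidean space, a connected manifold with one chart.
  let b := OpenPartialHomeomorph.univBall (pr x₀) ε
  have hbs : b.source = Set.univ := OpenPartialHomeomorph.univBall_source _ _
  have hbt : b.target = Metric.ball (pr x₀) ε := OpenPartialHomeomorph.univBall_target _ hε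
  have hb : ∀ s, b s ∈ Metric.ball (pr x₀) ε := fun s ↦
    hbt ▸ b.map_source (by simp [hbs])
  have hmem : ∀ s, (h x₀, b s) ∈ Metric.ball (Φ x₀) ε := fun s ↦ by
    have := hb s
    rw [Metric.mem_ball] at this ⊢
    simpa [Prod.dist_eq, Φ, hε] using this
  have hval : ∀ s, Φ (Ψ.symm (h x₀, b s)) = (h x₀, b s) := fun s ↦
    Ψ.right_inv (hball _ (hmem s)).1
  refine ⟨fun s ↦ Ψ.symm (h x₀, b s), fun x ↦ b.symm (pr x), ?_, fun s ↦ (hball _ (hmem s)).2.1,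
    fun s ↦ congrArg Prod.fst (hval s), ?_, ?_, ?_⟩
  · rw [contDiff_iff_contDiffAt]
    intro s
    obtain ⟨ht, hOs, e', he'⟩ := hball _ (hmem s)
    have hsymm : ContDiffAt ℝ ∞ Ψ.symm (h x₀, b s) := by
      refine Ψ.contDiffAt_symm (f₀' := e') ht ?_ (hΦd _ hOs)
      rw [he']
      exact ((hΦd _ hOs).differentiableAt (by simp)).hasFDerivAt
    exact hsymm.comp s (contDiffAt_const.prodMk
      (OpenPartialHomeomorph.contDiff_univBall (n := ⊤)).contDiffAt)
  · have : b 0 = pr x₀ := OpenPartialHomeomorph.univBall_apply_zero _ _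
    change Ψ.symm (h x₀, b 0) = x₀
    rw [this]
    exact Ψ.left_inv hsrc
  · intro s
    have : pr (Ψ.symm (h x₀, b s)) = b s := congrArg Prod.snd (hval s)
    change b.symm (pr (Ψ.symm (h x₀, b s))) = s
    rw [this]
    exact b.left_inv (by simp [hbs])
  · intro s
    have hpr : pr (Ψ.symm (h x₀, b s)) = b s := congrArg Prod.snd (hval s)
    have h1 : DifferentiableAt ℝ b.symm (pr (Ψ.symm (h x₀, b s))) := by
      rw [hpr]
      exact (((OpenPartialHomeomorph.contDiffOn_univBall_symm (n := 1)).contDiffAt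
        (Metric.isOpen_ball.mem_nhds (hb s))).differentiableAt (by simp))
    exact h1.comp _ pr.differentiableAt

/-- Through each point passes an integral submanifold of the distribution of `dτ`, for a function
`τ` without critical points. -/
theorem exists_isIntegralSubmanifold {τ : M → ℝ} (hτ : IsSmoothFun (n := n) τ)
    (hd : ∀ p, mvfderiv (𝓡 n) τ p ≠ 0) (p : M) :
    ∃ f : EuclideanSpace ℝ (Fin (n - 1)) → M, f 0 = p ∧
      IsIntegralSubmanifold (fun q ↦ LinearMap.ker (mvfderiv (𝓡 n) τ q).toLinearMap) f := by
  let φ := extChartAt (𝓡 n) p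
  let h : EuclideanSpace ℝ (Fin n) → ℝ := τ ∘ φ.symm
  have hO : IsOpen φ.target := isOpen_extChartAt_target p
  have hh : ContDiffOn ℝ ∞ h φ.target := by
    rw [← contMDiffOn_iff_contDiffOn]
    exact ContMDiff.comp_contMDiffOn hτ (contMDiffOn_extChartAt_symm p)
  have hx₀ : φ p ∈ φ.target := mem_extChartAt_target p
  have hdh : fderiv ℝ h (φ p) ≠ 0 := by
    intro h0
    apply hd p
    have heq : τ =ᶠ[𝓝 p] h ∘ φ := by
      filter_upwards [extChartAt_source_mem_nhds (I := 𝓡 n) p] with q hq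
      change τ q = τ (φ.symm (φ q))
      rw [φ.left_inv hq]
    have hm : mfderiv (𝓡 n) 𝓘(ℝ, ℝ) τ p = 0 := by
      rw [heq.mfderiv_eq, mfderiv_comp (I' := 𝓘(ℝ, EuclideanSpace ℝ (Fin n))) p
        (((hh _ hx₀).contDiffAt (hO.mem_nhds hx₀)).differentiableAt
          (by simp)).mdifferentiableAt
        (mdifferentiableAt_extChartAt (mem_chart_source _ p)), mfderiv_eq_fderiv, h0]
      exact ContinuousLinearMap.zero_comp _
    rw [mvfderiv, hm]
    exact ContinuousLinearMap.comp_zero _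
  obtain ⟨g, r, hg, hgO, hgh, hg0, hrg, hr⟩ := exists_levelSet_parametrization hO hh hx₀ hdh
  have hsm : ContMDiff (𝓡 (n - 1)) (𝓡 n) ∞ (φ.symm ∘ g) :=
    ContMDiffOn.comp_contMDiff (contMDiffOn_extChartAt_symm p) hg.contMDiff hgO
  have hleft : ∀ s, (r ∘ φ) ((φ.symm ∘ g) s) = s := fun s ↦ by
    simp only [Function.comp_apply]
    rw [φ.right_inv (hgO s), hrg]
  -- Differentiating the left inverse `r ∘ φ` gives a left inverse of the differential.
  have himm : ∀ s, Function.Injective (mfderiv (𝓡 (n - 1)) (𝓡 n) (φ.symm ∘ g) s) := fun s ↦ by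
    have hmem : (φ.symm ∘ g) s ∈ φ.source := φ.map_target (hgO s)
    have hrs : DifferentiableAt ℝ r (φ ((φ.symm ∘ g) s)) := by
      simp only [Function.comp_apply]
      rw [φ.right_inv (hgO s)]
      exact hr s
    have hR : MDifferentiableAt (𝓡 n) (𝓡 (n - 1)) (r ∘ φ) ((φ.symm ∘ g) s) :=
      MDifferentiableAt.comp (I' := 𝓘(ℝ, EuclideanSpace ℝ (Fin n))) _ hrs.mdifferentiableAt
        (mdifferentiableAt_extChartAt (by simpa [φ] using hmem))
    have hc := mfderiv_comp s hR (hsm.mdifferentiable (by simp) s)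
    have hid : (r ∘ φ) ∘ (φ.symm ∘ g) = id := funext hleft
    rw [hid, mfderiv_id] at hc
    intro v w hvw
    let B := mfderiv (𝓡 n) (𝓡 (n - 1)) (r ∘ φ) ((φ.symm ∘ g) s)
    let A := mfderiv (𝓡 (n - 1)) (𝓡 n) (φ.symm ∘ g) s
    have hv : v = B (A v) := congrArg (fun A ↦ A v) hc
    have hw : w = B (A w) := congrArg (fun A ↦ A w) hc
    exact hv.trans ((congrArg B hvw).trans hw.symm)
  refine ⟨φ.symm ∘ g, ?_, ?_, hsm, himm, ?_⟩
  · simp [hg0, φ]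
  · intro s t hst
    rw [← hleft s, hst, hleft t]
  · intro s
    let A := mfderiv (𝓡 (n - 1)) (𝓡 n) (φ.symm ∘ g) s
    let K := LinearMap.ker (mvfderiv (𝓡 n) τ ((φ.symm ∘ g) s)).toLinearMap
    -- `τ` is constant along the image, so tangent vectors lie in `ker dτ`; both spaces have
    -- dimension `n - 1`, hence coincide.
    have hle : LinearMap.range A.toLinearMap ≤ K := by
      rintro _ ⟨v, rfl⟩
      have hc := mvfderiv_comp s (hτ.mdiffAt ((φ.symm ∘ g) s)) (hsm.mdifferentiable (by simp) s)
      have hconst : τ ∘ (φ.symm ∘ g) = fun _ ↦ h (φ p) := funext hgh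
      rw [hconst, mvfderiv_const] at hc
      exact (congrArg (fun B ↦ B v) hc).symm
    have hK : Module.finrank ℝ K + 1 = n := by
      have hne : ((mvfderiv (𝓡 n) τ ((φ.symm ∘ g) s)).toLinearMap :
          Module.Dual ℝ (EuclideanSpace ℝ (Fin n))) ≠ 0 := fun h0 ↦
        hd ((φ.symm ∘ g) s) (by ext x; exact congrArg (fun f ↦ f x) h0)
      have := Module.Dual.finrank_ker_add_one_of_ne_zero hne
      exact this.trans (finrank_euclideanSpace_fin (𝕜 := ℝ) (n := n))
    have hrange : Module.finrank ℝ (LinearMap.range A.toLinearMap) = n - 1 := by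
      rw [LinearMap.finrank_range_of_inj (himm s)]
      exact finrank_euclideanSpace_fin
    have : FiniteDimensional ℝ K :=
      inferInstanceAs (FiniteDimensional ℝ (LinearMap.ker
        ((mvfderiv (𝓡 n) τ ((φ.symm ∘ g) s)).toLinearMap :
          EuclideanSpace ℝ (Fin n) →ₗ[ℝ] ℝ)))
    have heq := Submodule.eq_of_le_of_finrank_eq hle (by omega)
    intro v
    change v ∈ K ↔ _
    rw [← heq]
    rfl

/-- A function whose differential vanishes is constant on a connected manifold. -/
theorem eq_of_mvfderiv_eq_zero {m : ℕ} {S : Type*} [TopologicalSpace S]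
    [ChartedSpace (EuclideanSpace ℝ (Fin m)) S] [IsManifold (𝓡 m) ∞ S] [ConnectedSpace S]
    {u : S → ℝ} (hu : ContMDiff (𝓡 m) 𝓘(ℝ, ℝ) ∞ u) (h0 : ∀ s, mfderiv (𝓡 m) 𝓘(ℝ, ℝ) u s = 0)
    (s t : S) : u s = u t := by
  refine IsLocallyConstant.apply_eq_of_preconnectedSpace ?_ s t
  rw [IsLocallyConstant.iff_eventually_eq]
  intro s
  let φ := extChartAt (𝓡 m) s
  have hO : IsOpen φ.target := isOpen_extChartAt_target s
  obtain ⟨ε, hε, hball⟩ := Metric.isOpen_iff.1 hO (φ s) (mem_extChartAt_target s)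
  have hsm : ContDiffOn ℝ ∞ (u ∘ φ.symm) φ.target := by
    rw [← contMDiffOn_iff_contDiffOn]
    exact ContMDiff.comp_contMDiffOn hu (contMDiffOn_extChartAt_symm s)
  have hder : Set.EqOn (fderiv ℝ (u ∘ φ.symm)) 0 (Metric.ball (φ s) ε) := by
    intro x hx
    have hsx : MDifferentiableAt 𝓘(ℝ, EuclideanSpace ℝ (Fin m)) (𝓡 m) φ.symm x :=
      ((contMDiffOn_extChartAt_symm (n := ∞) s x (hball hx)).contMDiffAt
        (hO.mem_nhds (hball hx))).mdifferentiableAt (by simp)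
    rw [← mfderiv_eq_fderiv, mfderiv_comp x (hu.mdifferentiable (by simp) _) hsx, h0]
    exact ContinuousLinearMap.zero_comp _
  have hconst : ∀ x ∈ Metric.ball (φ s) ε, (u ∘ φ.symm) x = (u ∘ φ.symm) (φ s) := fun x hx ↦
    Metric.isOpen_ball.is_const_of_fderiv_eq_zero (convex_ball _ _).isPreconnected
      ((hsm.mono hball).differentiableOn (by simp)) hder hx (Metric.mem_ball_self hε)
  filter_upwards [extChartAt_source_mem_nhds (I := 𝓡 m) s,
    (continuousAt_extChartAt (I := 𝓡 m) s).preimage_mem_nhds (Metric.ball_mem_nhds _ hε)]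
    with t ht htb
  have := hconst (φ t) htb
  simp only [Function.comp_apply] at this
  rwa [φ.left_inv ht, φ.left_inv (mem_extChartAt_source s)] at this

/-- A smooth function is constant on the integral submanifolds of the distribution of `dτ` if and
only if its differential vanishes on the distribution. -/
theorem isConstantOnIntegralSubmanifolds_iff {τ k : M → ℝ} (hτ : IsSmoothFun (n := n) τ)
    (hd : ∀ p, mvfderiv (𝓡 n) τ p ≠ 0) (hk : IsSmoothFun (n := n) k) :
    IsConstantOnIntegralSubmanifolds
      (fun q ↦ LinearMap.ker (mvfderiv (𝓡 n) τ q).toLinearMap) k ↔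
      ∀ (p : M) (v : TangentSpace (𝓡 n) p), mvfderiv (𝓡 n) τ p v = 0 →
        mvfderiv (𝓡 n) k p v = 0 := by
  constructor
  · intro hconst p v hv
    -- Its parameter space is Euclidean, hence connected and in `Type`, so the constancy hypothesis
    -- applies to it.
    obtain ⟨f, rfl, hf⟩ := exists_isIntegralSubmanifold hτ hd p
    obtain ⟨w, hw⟩ := (hf.tangent 0 v).1 hv
    have hc := mvfderiv_comp 0 (hk.mdiffAt (f 0)) (hf.smooth.mdifferentiable (by simp) 0)
    have hkf : k ∘ f = fun _ ↦ k (f 0) := funext fun s ↦ hconst _ f hf s 0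
    rw [hkf, mvfderiv_const] at hc
    have := (congrArg (fun B ↦ B w) hc).symm
    rw [ContinuousLinearMap.comp_apply, hw] at this
    exact this
  · intro h S _ _ _ _ f hf s t
    refine eq_of_mvfderiv_eq_zero (u := k ∘ f) (ContMDiff.comp hk hf.smooth) (fun s ↦ ?_) s t
    rw [mfderiv_comp s (hk.mdiffAt (f s)) (hf.smooth.mdifferentiable (by simp) s)]
    ext v
    exact h (f s) _ ((hf.tangent s _).2 ⟨v, rfl⟩)

end LevelSets

/-! ### Consequences of `dτ = K η` for `η` and `ξ` -/

section Directed

variable [RiemannianBundle (fun p : M ↦ TangentSpace (𝓡 n) p)]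
  [IsContMDiffRiemannianBundle (𝓡 n) ∞ (EuclideanSpace ℝ (Fin n))
    (fun p : M ↦ TangentSpace (𝓡 n) p)]
  {D : TangentConnection n M} {ξ : ∀ p : M, TangentSpace (𝓡 n) p}
  {κ : ∀ p : M, Submodule ℝ (TangentSpace (𝓡 n) p) → ℝ} {k : M → ℝ}

/-- If the manifold is directed by `η` with pointwise constant relative sectional curvature `k`,
then the sectional form of each plane is `k η`. -/
theorem IsDirectedBy.sectionalForm_eq {η : ∀ p : M, TangentSpace (𝓡 n) p →L[ℝ] ℝ}
    (hdir : IsDirectedBy D η κ) (hconst : IsPointwiseConstant η κ k) (p : M)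
    {x y : TangentSpace (𝓡 n) p} (hx : ‖x‖ = 1) (hy : ‖y‖ = 1) (hxy : ⟪x, y⟫_ℝ = 0) :
    sectionalForm D p x y x = k p * η p x := by
  have hmem : x ∈ Submodule.span ℝ {x, y} := Submodule.subset_span (by simp)
  obtain ⟨h1, h2⟩ := hdir p _ x y hx hy hxy rfl
  -- For planes inside the distribution `η x = 0`, so the formula `k η` covers both cases.
  by_cases hE : Submodule.span ℝ {x, y} ≤ distributionOf η p
  · have h0 : η p x = 0 := hE hmem
    rw [h2 hE x hmem, h0, mul_zero]
  · have hon : Orthonormal ℝ ![x, y] := by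
      rw [orthonormal_iff_ite]
      intro i j
      fin_cases i <;> fin_cases j <;>
        simp [hx, hy, hxy, real_inner_comm]
    have hfr := finrank_span_eq_card hon.linearIndependent
    rw [Matrix.range_cons_cons_empty, Fintype.card_fin] at hfr
    rw [h1 hE x hmem, hconst p _ hfr hE]

variable [T2Space M]

/-- The scalar form of a manifold of pointwise constant relative sectional curvature. -/
theorem two_mul_scalarForm (hD : IsLeviCivita D) (hdir : IsDirectedBy D (dualForm ξ) κ)
    (hconst : IsPointwiseConstant (dualForm ξ) κ k) (p : M) (w : TangentSpace (𝓡 n) p) :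
    2 * scalarForm D p w = ((n : ℝ) - 1) * ((n : ℝ) + 2) * k p * ⟪ξ p, w⟫_ℝ := by
  obtain ⟨e, he⟩ := exists_scalarForm_eq_sum hD p
  rw [he]
  exact two_mul_trace_eq (isAlgebraicCurvature_covDerivCurvatureAt hD p)
    (covDerivCurvatureAt_bianchi hD p) e (dualForm ξ p).toLinearMap (k p)
    (fun x y hx hy hxy ↦ hdir.sectionalForm_eq hconst p hx hy hxy) w

/-- The scalar form vanishes in dimension less than two. -/
theorem two_le_of_scalarForm_ne_zero (hD : IsLeviCivita D) {p : M} (h : scalarForm D p ≠ 0) :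
    2 ≤ n := by
  by_contra hn
  apply h
  obtain ⟨e, he⟩ := exists_scalarForm_eq_sum hD p
  ext w
  rw [he]
  have : Subsingleton (Fin n) := Fin.subsingleton_iff_le_one.2 (by omega)
  refine Finset.sum_eq_zero fun i _ ↦ Finset.sum_eq_zero fun j _ ↦ ?_
  rw [Subsingleton.elim j i]
  exact (isAlgebraicCurvature_covDerivCurvatureAt hD p w).self_left _ _ _

/-- If `dτ = k η`, with `η` the form dual to `ξ`, then the differential of `k` satisfies
`X(k) η(Y) - Y(k) η(X) + k dη(X, Y) = 0`. -/
theorem dirDeriv_wedge_dualForm {τ : M → ℝ} (hτ : IsSmoothFun (n := n) τ)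
    (hk : IsSmoothFun (n := n) k) (hξ : IsSmoothField ξ)
    (h : ∀ (p : M) (w : TangentSpace (𝓡 n) p), mvfderiv (𝓡 n) τ p w = k p * ⟪ξ p, w⟫_ℝ)
    {X Y : ∀ p : M, TangentSpace (𝓡 n) p} (hX : IsSmoothField X) (hY : IsSmoothField Y) (p : M) :
    dirDeriv X k p * ⟪ξ p, Y p⟫_ℝ - dirDeriv Y k p * ⟪ξ p, X p⟫_ℝ
      + k p * (dirDeriv X (fun q ↦ ⟪ξ q, Y q⟫_ℝ) p - dirDeriv Y (fun q ↦ ⟪ξ q, X q⟫_ℝ) p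
        - ⟪ξ p, lieField X Y p⟫_ℝ) = 0 := by
  have hdir : ∀ Z : ∀ p : M, TangentSpace (𝓡 n) p,
      dirDeriv Z τ = fun q ↦ k q * ⟪ξ q, Z q⟫_ℝ := fun Z ↦ funext fun q ↦ h q (Z q)
  -- This is `d(dτ) = 0`, into which `dτ = k η` is substituted.
  have hl := dirDeriv_lieField hX hY hτ p
  rw [hdir, hdir, hdir, dirDeriv_mul hk (hξ.inner hY), dirDeriv_mul hk (hξ.inner hX)] at hl
  linear_combination -hl

/-- For a unit field `ξ` with dual form `η`, `dη(ξ, X) = g(D_ξ ξ, X)`. -/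
theorem extDeriv_dualForm_unitField (hD : IsLeviCivita D) (hξ : IsUnitField ξ)
    {X : ∀ p : M, TangentSpace (𝓡 n) p} (hX : IsSmoothField X) (p : M) :
    dirDeriv ξ (fun q ↦ ⟪ξ q, X q⟫_ℝ) p - dirDeriv X (fun q ↦ ⟪ξ q, ξ q⟫_ℝ) p
        - ⟪ξ p, lieField ξ X p⟫_ℝ = ⟪D ξ p (ξ p), X p⟫_ℝ := by
  have h1 : (fun q ↦ ⟪ξ q, ξ q⟫_ℝ) = fun _ ↦ (1 : ℝ) := funext fun q ↦ by
    rw [real_inner_self_eq_norm_sq, hξ.2 q]; norm_num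
  have h2 : dirDeriv X (fun q ↦ ⟪ξ q, ξ q⟫_ℝ) p = 0 := by
    rw [h1]; simp [dirDeriv, mvfderiv_const]
  -- Constant length of `ξ` gives `g(∇_X ξ, ξ) = 0`, which removes the other torsion term.
  have h3 := congrFun (dirDeriv_inner (W := X) hD hξ.1 hξ.1) p
  have h4 := congrFun (dirDeriv_inner (W := ξ) hD hξ.1 hX) p
  have h5 := real_inner_comm (ξ p) (covField D X ξ p)
  rw [h2] at h3 ⊢
  rw [h4, ← covField_torsion hD hξ.1 hX, Pi.sub_apply, inner_sub_right]
  change _ = ⟪covField D ξ ξ p, X p⟫_ℝ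
  linarith

/-- If `dτ = k η` with `k` nowhere zero and `η` the form dual to `ξ`, then `η` is closed if and only if
the differential of `k` vanishes on the distribution of `η`. -/
theorem isClosedForm_dualForm_iff {τ : M → ℝ} (hτ : IsSmoothFun (n := n) τ)
    (hk : IsSmoothFun (n := n) k) (hk0 : ∀ p, k p ≠ 0) (hξ : IsUnitField ξ)
    (h : ∀ (p : M) (w : TangentSpace (𝓡 n) p), mvfderiv (𝓡 n) τ p w = k p * ⟪ξ p, w⟫_ℝ) :
    IsClosedForm (dualForm ξ) ↔
      ∀ (p : M) (v : TangentSpace (𝓡 n) p), mvfderiv (𝓡 n) τ p v = 0 →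
        mvfderiv (𝓡 n) k p v = 0 := by
  have hunit : ∀ p, ⟪ξ p, ξ p⟫_ℝ = 1 := fun p ↦ by
    rw [real_inner_self_eq_norm_sq, hξ.2 p]; norm_num
  constructor
  · intro hclosed p v hv
    obtain ⟨X, hX, rfl⟩ := exists_isSmoothField_apply v
    have hX0 : ⟪ξ p, X p⟫_ℝ = 0 := by
      rw [h] at hv
      exact (mul_eq_zero.1 hv).resolve_left (hk0 p)
    have hw := dirDeriv_wedge_dualForm hτ hk hξ.1 h hX hξ.1 p
    have hc : dirDeriv X (fun q ↦ ⟪ξ q, ξ q⟫_ℝ) p - dirDeriv ξ (fun q ↦ ⟪ξ q, X q⟫_ℝ) p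
      - ⟪ξ p, lieField X ξ p⟫_ℝ = 0 := hclosed X ξ hX hξ.1 p
    rw [hc, hX0, hunit] at hw
    change dirDeriv X k p = 0
    linarith
  · intro hd X Y hX hY p
    have hw := dirDeriv_wedge_dualForm hτ hk hξ.1 h hX hY p
    -- Vanishing on `ker η` makes `dk` a multiple of `η`, so `dk ∧ η = 0` and only `k dη` is left.
    have hdk : ∀ v : TangentSpace (𝓡 n) p,
        mvfderiv (𝓡 n) k p v = ⟪ξ p, v⟫_ℝ * mvfderiv (𝓡 n) k p (ξ p) := fun v ↦ by
      have := hd p (v - ⟪ξ p, v⟫_ℝ • ξ p) (by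
        rw [h, inner_sub_right, real_inner_smul_right, hunit]; ring)
      rw [map_sub, map_smul, smul_eq_mul] at this
      linarith
    have h1 : dirDeriv X k p = _ := hdk (X p)
    have h2 : dirDeriv Y k p = _ := hdk (Y p)
    rw [h1, h2] at hw
    refine (mul_eq_zero.1 (?_ : k p * _ = 0)).resolve_left (hk0 p)
    rw [← hw]
    simp only [dualForm, innerSL_apply_apply, dirDeriv, lieField]
    ring

/-- If `dτ = k η` with `k` nowhere zero and `η` the form dual to the unit field `ξ`, then `ξ` is
geodesic if and only if `η` is closed. -/
theorem isGeodesicField_iff_isClosedForm (hD : IsLeviCivita D) {τ : M → ℝ}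
    (hτ : IsSmoothFun (n := n) τ)
    (hk : IsSmoothFun (n := n) k) (hk0 : ∀ p, k p ≠ 0) (hξ : IsUnitField ξ)
    (h : ∀ (p : M) (w : TangentSpace (𝓡 n) p), mvfderiv (𝓡 n) τ p w = k p * ⟪ξ p, w⟫_ℝ) :
    IsGeodesicField D ξ ↔ IsClosedForm (dualForm ξ) := by
  constructor
  · intro hgeo
    rw [isClosedForm_dualForm_iff hτ hk hk0 hξ h]
    intro p v hv
    obtain ⟨X, hX, rfl⟩ := exists_isSmoothField_apply v
    have hX0 : ⟪ξ p, X p⟫_ℝ = 0 := by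
      rw [h] at hv
      exact (mul_eq_zero.1 hv).resolve_left (hk0 p)
    -- On the pair `(ξ, X)` with `X` orthogonal to `ξ` at `p`, the identity reads `X(k) = k g(∇_ξ ξ,
    -- X)`.
    have hw := dirDeriv_wedge_dualForm hτ hk hξ.1 h hξ.1 hX p
    rw [extDeriv_dualForm_unitField hD hξ hX p, hgeo p, inner_zero_left, hX0,
      real_inner_self_eq_norm_sq, hξ.2 p] at hw
    change dirDeriv X k p = 0
    linarith
  · intro hclosed p
    obtain ⟨X, hX, hXp⟩ := exists_isSmoothField_apply (D ξ p (ξ p))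
    have he := extDeriv_dualForm_unitField hD hξ hX p
    have hc : dirDeriv ξ (fun q ↦ ⟪ξ q, X q⟫_ℝ) p - dirDeriv X (fun q ↦ ⟪ξ q, ξ q⟫_ℝ) p
      - ⟪ξ p, lieField ξ X p⟫_ℝ = 0 := hclosed ξ X hξ.1 hX p
    rw [hc, hXp] at he
    exact inner_self_eq_zero.1 he.symm

end Directed

end DirectedRiemannian

end

/-! ### The two equivalences -/

theorem theorem4p2 {n : ℕ} {M : Type*} [TopologicalSpace M] [T2Space M]
    [SecondCountableTopology M] [ChartedSpace (EuclideanSpace ℝ (Fin n)) M]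
    [IsManifold (𝓡 n) ∞ M]
    [RiemannianBundle (fun p : M ↦ TangentSpace (𝓡 n) p)]
    [IsContMDiffRiemannianBundle (𝓡 n) ∞ (EuclideanSpace ℝ (Fin n))
      (fun p : M ↦ TangentSpace (𝓡 n) p)]
    (D : DirectedRiemannian.TangentConnection n M)
    (hD : DirectedRiemannian.IsLeviCivita D)
    (ξ : ∀ p : M, TangentSpace (𝓡 n) p)
    (hξ : DirectedRiemannian.IsUnitField ξ)
    (κ : ∀ p : M, Submodule ℝ (TangentSpace (𝓡 n) p) → ℝ)
    (hdirected : DirectedRiemannian.IsDirectedBy D (DirectedRiemannian.dualForm ξ) κ)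
    (k : M → ℝ)
    (hconst : DirectedRiemannian.IsPointwiseConstant (DirectedRiemannian.dualForm ξ) κ k)
    (hτ : ∀ p : M, DirectedRiemannian.scalarForm D p ≠ 0)
    (hk : ∀ p : M, k p = 2 * ‖DirectedRiemannian.scalarForm D p‖ / (((n : ℝ) - 1) * ((n : ℝ) + 2)))
    (humb : DirectedRiemannian.IsTotallyUmbilical D (DirectedRiemannian.scalarDistribution D)) :
    (DirectedRiemannian.IsConstantOnIntegralSubmanifolds
        (DirectedRiemannian.scalarDistribution D) k ↔
      DirectedRiemannian.IsClosedForm (DirectedRiemannian.dualForm ξ)) ∧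
    (DirectedRiemannian.IsConstantOnIntegralSubmanifolds
        (DirectedRiemannian.scalarDistribution D) k ↔
      DirectedRiemannian.IsGeodesicField D ξ) := by
  have hform (p : M) (w : TangentSpace (𝓡 n) p) :=
    DirectedRiemannian.two_mul_scalarForm hD hdirected hconst p w
  have hunit : ∀ p, ⟪ξ p, ξ p⟫_ℝ = 1 := fun p ↦ by
    rw [real_inner_self_eq_norm_sq, hξ.2 p]; norm_num
  -- `K = ξ(τ)` is smooth by construction, whereas smoothness of `k` is not given; `K` is a constant
  -- multiple of `k`, so it can replace `k` throughout.
  let K : M → ℝ := DirectedRiemannian.dirDeriv ξ (DirectedRiemannian.scalarCurvature D)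
  have hτs := DirectedRiemannian.isSmoothFun_scalarCurvature hD
  have hK : DirectedRiemannian.IsSmoothFun (n := n) K := hτs.dirDeriv hξ.1
  have hKk (p : M) : 2 * K p = ((n : ℝ) - 1) * ((n : ℝ) + 2) * k p := by
    have := hform p (ξ p)
    rwa [hunit, mul_one] at this
  have hdτ (p : M) (w : TangentSpace (𝓡 n) p) :
      mvfderiv (𝓡 n) (DirectedRiemannian.scalarCurvature D) p w = K p * ⟪ξ p, w⟫_ℝ := by
    have h1 : 2 * mvfderiv (𝓡 n) (DirectedRiemannian.scalarCurvature D) p w = _ := hform p w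
    linear_combination h1 / 2 - ⟪ξ p, w⟫_ℝ / 2 * hKk p
  have hK0 (p : M) : K p ≠ 0 := fun h0 ↦ hτ p (by
    ext w
    refine (hdτ p w).trans ?_
    rw [h0, zero_mul]
    rfl)
  have hconstK : DirectedRiemannian.IsConstantOnIntegralSubmanifolds
      (DirectedRiemannian.scalarDistribution D) k ↔
      DirectedRiemannian.IsConstantOnIntegralSubmanifolds
        (DirectedRiemannian.scalarDistribution D) K := by
    refine forall_congr' fun S ↦ ?_
    refine forall₄_congr fun _ _ _ _ ↦ forall₂_congr fun f _ ↦ forall₂_congr fun s t ↦ ?_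
    -- Cancelling `(n-1)(n+2)` requires `n ≥ 2`, which follows from `dτ ≠ 0` at a point of the
    -- submanifold.
    have hn : (2 : ℝ) ≤ n := by
      exact_mod_cast DirectedRiemannian.two_le_of_scalarForm_ne_zero hD (hτ (f s))
    have hc : ((n : ℝ) - 1) * ((n : ℝ) + 2) ≠ 0 := by
      have : (0 : ℝ) < n - 1 := by linarith
      positivity
    rw [← mul_right_inj' hc, ← hKk, ← hKk, mul_right_inj' two_ne_zero]
  have hclosed := DirectedRiemannian.isClosedForm_dualForm_iff hτs hK hK0 hξ hdτ
  have hiff := hconstK.trans ((DirectedRiemannian.isConstantOnIntegralSubmanifolds_iff hτs hτ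
    hK).trans hclosed.symm)
  exact ⟨hiff, hiff.trans
    (DirectedRiemannian.isGeodesicField_iff_isClosedForm hD hτs hK hK0 hξ hdτ).symm⟩
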